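/- Let $\mathbb{K}$ be a field. A (Heisenberg–Weyl) diagram $\Gamma$ is an isomorphism class of finite directed graphs with vertex set $V_\Gamma$, set of lines $E_\Gamma$, and partially defined head and tail maps $h,t:E_\Gamma\rightharpoonup V_\Gamma$ such that every line has at least one end attached to a vertex, every vertex is an end of at least one line, and there are no directed cycles (no lines $e_1,\dots,e_n$, $n\ge 1$, with $h(e_k)=t(e_{k+1})$ for $k<n$ and $h(e_n)=t(e_1)$). Let $\Gamma^-$ be the set of lines with free tail (incoming) and $\Gamma^+$ the set of lines with free head (outgoing), and let $\emptyset$ denote the empty diagram. A matching of $\Gamma_2^-$ with $\Gamma_1^+$ is a set $m\subseteq\Gamma_2^-\times\Gamma_1^+$ of pairs with pairwise distinct first and pairwise distinct second components; the composite $\Gamma_2\triangleleft_m\Gamma_1$ is obtained from the disjoint union of $\Gamma_2$ and $\Gamma_1$ by replacing, for each $(e_2,e_1)\in m$, the lines $e_2,e_1$ by a single line with the head of $e_2$ and the tail of $e_1$. For $A\subseteq E_\Gamma$, let $\Gamma|_A$ be the subgraph consisting of the lines in $A$ and their end vertices. Let $\mathcal{G}$ be the $\mathbb{K}$-vector space with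 basis the set of all diagrams. Then the following formulas (in which diagrams are represented by graphs, the result not depending on the representatives) define a Hopf algebra structure on $\mathcal{G}$ over $\mathbb{K}$, with co-commutative coproduct: - product $\Gamma_2*\Gamma_1=\sum_{m}\Gamma_2\triangleleft_m\Gamma_1$, the sum over all matchings $m$ of $\Gamma_2^-$ with $\Gamma_1^+$, with unit $\emptyset$; - coproduct $\Delta(\Gamma)=\sum_{L+R=E_\Gamma}\Gamma|_L\otimes\Gamma|_R$, the sum over ordered partitions of $E_\Gamma$ into two (possibly empty) subsets $L,R$; - counit $\varepsilon(\emptyset)=1$ and $\varepsilon(\Gamma)=0$ for $\Gamma\neq\emptyset$; - antipode $S(\emptyset)=\emptyset$ and, for $\Gamma\neq\emptyset$, $$S(\Gamma)=\sum_{\substack{A_n+\dots+A_1=E_\Gamma\\ A_n,\dots,A_1\neq\emptyset}}(-1)^n\,\Gamma|_{A_n}*\dots*\Gamma|_{A_1},$$ the sum over all $n$ and all ordered partitions of $E_\Gamma$ into $n$ nonempty blocks. -/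

import Mathlib

open scoped TensorProduct

namespace HeisenbergWeyl

/-- A representative of a Heisenberg-Weyl diagram: a finite directed graph with vertices `V` and
lines `E`, whose head and tail maps are partially defined (`none` means that the end is free).
A line may have at most one free end, there are no directed cycles, and every vertex is an end of
some line (so a graph is carried by its lines, and the only graph without lines is the empty
one). -/
structure Graph where
  V : Type
  E : Type
  [finiteV : Finite V]
  [finiteE : Finite E]
  head : E → Option V
  tail : E → Option V
  /-- `dom(h) ∪ dom(t) = E`. -/
  attached : ∀ e, head e ≠ none ∨ tail e ≠ none
  /-- There is no sequence of lines `e₁, …, eₙ`, `n ≥ 1`, with `h(eₖ) = t(eₖ₊₁)` for `k < n` and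
  `h(eₙ) = t(e₁)` (all of these ends being attached to vertices). -/
  acyclic : ∀ e, ¬ Relation.TransGen (fun e f => ∃ v, head e = some v ∧ tail f = some v) e e
  covered : ∀ v, ∃ e, head e = some v ∨ tail e = some v

namespace Graph

attribute [instance] Graph.finiteV Graph.finiteE

noncomputable instance fintypeE (Γ : Graph) : Fintype Γ.E := Fintype.ofFinite _

/-- Equivalence of graphs: bijections of lines and of vertices that transport the partial maps
`h` and `t`. -/
def Equivalent (Γ Γ' : Graph) : Prop :=
  ∃ (αE : Γ.E ≃ Γ'.E) (αV : Γ.V ≃ Γ'.V),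
    (∀ e, Γ'.head (αE e) = (Γ.head e).map αV) ∧ ∀ e, Γ'.tail (αE e) = (Γ.tail e).map αV

theorem equivalent_equivalence : Equivalence Equivalent where
  refl Γ := ⟨Equiv.refl _, Equiv.refl _, by simp, by simp⟩
  symm := by
    rintro Γ Γ' ⟨a, b, h, t⟩
    refine ⟨a.symm, b.symm, fun e => ?_, fun e => ?_⟩
    · obtain ⟨e, rfl⟩ := a.surjective e
      simp [h, Function.comp_def]
    · obtain ⟨e, rfl⟩ := a.surjective e
      simp [t, Function.comp_def]
  trans := by
    rintro Γ Γ' Γ'' ⟨a, b, h, t⟩ ⟨a', b', h', t'⟩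
    refine ⟨a.trans a', b.trans b', fun e => ?_, fun e => ?_⟩
    · simp [h, h', Function.comp_def]
    · simp [t, t', Function.comp_def]

instance setoid : Setoid Graph := ⟨Equivalent, equivalent_equivalence⟩

/-- The empty graph: no vertices, no lines. -/
def empty : Graph where
  V := Empty
  E := Empty
  head := Empty.elim
  tail := Empty.elim
  attached e := e.elim
  acyclic e := e.elim
  covered v := v.elim

/-- The subgraph `Γ|_A` given by a set `A` of lines: the head and tail maps are restricted to `A`,
and the vertices are the ends of the lines in `A`. -/
def restrict (Γ : Graph) (A : Set Γ.E) : Graph where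
  V := {v : Γ.V // ∃ e ∈ A, Γ.head e = some v ∨ Γ.tail e = some v}
  E := A
  head e := (Γ.head e).pmap Subtype.mk fun _ hv => ⟨e, e.2, Or.inl hv⟩
  tail e := (Γ.tail e).pmap Subtype.mk fun _ hv => ⟨e, e.2, Or.inr hv⟩
  attached e := by simpa using Γ.attached e
  acyclic e he := by
    refine Γ.acyclic e (he.lift Subtype.val ?_)
    rintro a b ⟨v, hv, hv'⟩
    simp only [Option.pmap_eq_some_iff] at hv hv'
    obtain ⟨x, _, hx, rfl⟩ := hv
    obtain ⟨y, _, hy, hxy⟩ := hv'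
    simp only [Subtype.mk.injEq] at hxy
    subst hxy
    exact ⟨x, hx, hy⟩
  covered := by
    rintro ⟨v, e, he, hv⟩
    refine ⟨⟨e, he⟩, ?_⟩
    simp only [Option.pmap_eq_some_iff]
    exact hv.imp (fun h => ⟨v, ⟨e, he, hv⟩, h, rfl⟩) (fun h => ⟨v, ⟨e, he, hv⟩, h, rfl⟩)

end Graph

/-- A matching of the incoming lines of `Γ₂` (free tails) with the outgoing lines of `Γ₁` (free
heads): a set of pairs, distinct pairs having distinct first and distinct second components. -/
@[ext] structure Matching (Γ₂ Γ₁ : Graph) where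
  pairs : Set (Γ₂.E × Γ₁.E)
  incoming : ∀ p ∈ pairs, Γ₂.tail p.1 = none
  outgoing : ∀ p ∈ pairs, Γ₁.head p.2 = none
  fst_inj : ∀ p ∈ pairs, ∀ q ∈ pairs, p.1 = q.1 → p = q
  snd_inj : ∀ p ∈ pairs, ∀ q ∈ pairs, p.2 = q.2 → p = q

instance (Γ₂ Γ₁ : Graph) : Finite (Matching Γ₂ Γ₁) :=
  Finite.of_injective Matching.pairs fun _ _ h => Matching.ext h

noncomputable instance (Γ₂ Γ₁ : Graph) : Fintype (Matching Γ₂ Γ₁) := Fintype.ofFinite _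

namespace Graph

variable {Γ₂ Γ₁ : Graph} (m : Matching Γ₂ Γ₁)

/-- Lines of the composite graph: the unmatched lines of `Γ₂`, the unmatched lines of `Γ₁`, and
one line for each matched pair. -/
abbrev ComposeE : Type :=
  {e : Γ₂.E // ∀ p ∈ m.pairs, p.1 ≠ e} ⊕ {e : Γ₁.E // ∀ p ∈ m.pairs, p.2 ≠ e} ⊕ m.pairs

def composeHead : ComposeE m → Option (Γ₂.V ⊕ Γ₁.V)
  | .inl e => (Γ₂.head e.1).map Sum.inl
  | .inr (.inl e) => (Γ₁.head e.1).map Sum.inr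
  | .inr (.inr p) => (Γ₂.head p.1.1).map Sum.inl

def composeTail : ComposeE m → Option (Γ₂.V ⊕ Γ₁.V)
  | .inl e => (Γ₂.tail e.1).map Sum.inl
  | .inr (.inl e) => (Γ₁.tail e.1).map Sum.inr
  | .inr (.inr p) => (Γ₁.tail p.1.2).map Sum.inr

/-- What a directed path in the composite graph amounts to (used for acyclicity only). -/
def ComposePath : ComposeE m → ComposeE m → Prop
  | .inl e, .inl f =>
      Relation.TransGen (fun e f => ∃ v, Γ₂.head e = some v ∧ Γ₂.tail f = some v) e.1 f.1
  | .inr (.inl e), .inr (.inl f) =>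
      Relation.TransGen (fun e f => ∃ v, Γ₁.head e = some v ∧ Γ₁.tail f = some v) e.1 f.1
  | .inl _, .inr _ => False
  | .inr (.inr _), .inr _ => False
  | .inr (.inr _), .inl _ => True
  | .inr (.inl _), .inl _ => True
  | .inr (.inl _), .inr (.inr _) => True

theorem composePath_of_step {e f : ComposeE m}
    (h : ∃ v, composeHead m e = some v ∧ composeTail m f = some v) : ComposePath m e f := by
  obtain ⟨v, hv, hv'⟩ := h
  rcases e with e | e | e <;> rcases f with f | f | f <;>
    simp only [composeHead, composeTail, Option.map_eq_some_iff] at hv hv' <;>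
    obtain ⟨a, ha, rfl⟩ := hv <;> obtain ⟨b, hb, hab⟩ := hv' <;>
    cases hab <;> simp only [ComposePath]
  · exact .single ⟨a, ha, hb⟩
  · exact .single ⟨a, ha, hb⟩

theorem composePath_trans {e f g : ComposeE m} (h : ComposePath m e f)
    (h' : ComposePath m f g) : ComposePath m e g := by
  rcases e with e | e | e <;> rcases f with f | f | f <;> rcases g with g | g | g <;>
    simp only [ComposePath] at h h' ⊢
  · exact h.trans h'
  · exact h.trans h'

/-- The composite graph of `Γ₂` (on top) with `Γ₁` (below), joining the lines coupled by the
matching `m`: the line obtained from `(e₂, e₁) ∈ m` has the head of `e₂` and the tail of `e₁`. -/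
def compose : Graph where
  V := Γ₂.V ⊕ Γ₁.V
  E := ComposeE m
  head := composeHead m
  tail := composeTail m
  attached := by
    rintro (e | e | p)
    · simpa [composeHead, composeTail] using Γ₂.attached e
    · simpa [composeHead, composeTail] using Γ₁.attached e
    · have h := (Γ₂.attached p.1.1).resolve_right (not_not.2 (m.incoming p.1 p.2))
      exact Or.inl (by simpa [composeHead] using h)
  acyclic e he := by
    have key : ComposePath m e e := by
      have : ∀ f, Relation.TransGen
          (fun e f => ∃ v, composeHead m e = some v ∧ composeTail m f = some v) e f →
          ComposePath m e f := by
        intro f hf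
        induction hf with
        | single h => exact composePath_of_step m h
        | tail _ h ih => exact composePath_trans m ih (composePath_of_step m h)
      exact this e he
    rcases e with e | e | e
    · exact Γ₂.acyclic _ key
    · exact Γ₁.acyclic _ key
    · exact key
  covered := by
    rintro (v | v)
    · obtain ⟨e, he⟩ := Γ₂.covered v
      by_cases h : ∃ p ∈ m.pairs, p.1 = e
      · obtain ⟨p, hp, rfl⟩ := h
        refine ⟨.inr (.inr ⟨p, hp⟩), Or.inl ?_⟩
        simpa [composeHead, m.incoming p hp] using he
      · push Not at h
        exact ⟨.inl ⟨e, h⟩, by simpa [composeHead, composeTail] using he⟩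
    · obtain ⟨e, he⟩ := Γ₁.covered v
      by_cases h : ∃ p ∈ m.pairs, p.2 = e
      · obtain ⟨p, hp, rfl⟩ := h
        refine ⟨.inr (.inr ⟨p, hp⟩), Or.inr ?_⟩
        simpa [composeTail, m.outgoing p hp] using he
      · push Not at h
        exact ⟨.inr (.inl ⟨e, h⟩), by simpa [composeHead, composeTail] using he⟩

end Graph

/-- Heisenberg-Weyl diagrams: equivalence classes of graphs. -/
def Diagram : Type 1 := Quotient Graph.setoid

/-- The void diagram, i.e. the class of the empty graph. -/
def Diagram.void : Diagram := Quotient.mk _ Graph.empty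

/-- The diagram represented by a graph. -/
def Graph.diagram (Γ : Graph) : Diagram := Quotient.mk _ Γ

/-- The underlying set of the vector space with basis all diagrams: finite formal linear
combinations of diagrams. No algebraic structure is put on it here. -/
def Space (K : Type*) [Field K] : Type _ := Diagram →₀ K

namespace Space

variable {K : Type*} [Field K]

/-- The coefficient of a diagram in a formal linear combination. -/
def coeff (x : Space K) (d : Diagram) : K := DFunLike.coe (F := Diagram →₀ K) x d

/-- A diagram as a basis element. -/
noncomputable def ofDiagram (K : Type*) [Field K] (d : Diagram) : Space K :=
  (Finsupp.single d (1 : K) : Diagram →₀ K)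

end Space

/-- The basis element given by the diagram that a graph represents. -/
noncomputable def Graph.basis (K : Type*) [Field K] (Γ : Graph) : Space K :=
  Space.ofDiagram K Γ.diagram

/-- Ordered partitions of `E` into `n` nonempty blocks. -/
@[ext] structure OrderedPartition (E : Type) (n : ℕ) where
  block : Fin n → Set E
  nonempty : ∀ i, (block i).Nonempty
  disjoint : ∀ i j, i ≠ j → Disjoint (block i) (block j)
  cover : ⋃ i, block i = Set.univ

instance (E : Type) [Finite E] (n : ℕ) : Finite (OrderedPartition E n) :=
  Finite.of_injective OrderedPartition.block fun _ _ h => OrderedPartition.ext h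

noncomputable instance (E : Type) [Finite E] (n : ℕ) : Fintype (OrderedPartition E n) :=
  Fintype.ofFinite _

/-- An ordered partition into nonempty blocks has at most `|E|` blocks, so a sum over `n ≤ |E|`
runs over all ordered partitions. -/
theorem OrderedPartition.le_card {E : Type} [Fintype E] {n : ℕ} (P : OrderedPartition E n) :
    n ≤ Fintype.card E := by
  choose f hf using P.nonempty
  have hinj : Function.Injective f := by
    intro i j hij
    by_contra hne
    exact Set.disjoint_left.1 (P.disjoint i j hne) (hf i) (hij ▸ hf j)
  simpa using Fintype.card_le_of_injective f hinj

end HeisenbergWeyl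

/-!
The proof describes a graph by its *flags*, the attached ends of its lines, with three relations:
being a head, belonging to the same line, and sitting at the same vertex (`Flags`). Since every line
and every vertex carries a flag, two graphs are equivalent exactly if their flags are isomorphic
(`Graph.equivalent_iff_iso`). In these terms the operations are transparent: composing along a
matching is a disjoint union of flags together with new pairs of flags on the same line
(`Graph.flags_compose`), and restricting to a set of lines is passing to a subset of the flags
(`Graph.flags_restrict`).

* Associativity: both bracketings of a triple composition are given by a relation between each two
  of the three sets of flags (`Flags.Gluing.assocEquiv`). No two of these relations can compete for
  a line of the middle factor, because a line with both ends free does not exist.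
* The coproduct is multiplicative (`Flags.sum_splitSum_glue`): a union of lines in a composite is a
  union of lines in each factor that is respected by the matching, and a matching that respects
  such unions is a pair of matchings, one of the chosen parts and one of their complements
  (`Flags.closedGlueEquiv`, `Flags.Gluing.splitEquiv`).
* Coassociativity: both iterated coproducts sum over the ordered partitions of the lines into three
  parts (`sum_subset_sdiff`).
* Antipode: let `J` be the identity minus unit composed with counit. Its convolution power `J ^ n`
  sums the products of the restrictions over all ordered partitions of the lines into `n` nonempty
  blocks (`Space.reduced_pow_basis`), so it vanishes on graphs with fewer than `n` lines. The
  geometric series of `-J` is therefore a finite sum on each graph, and it is the convolution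
  inverse of `1 + J`, the identity.
-/

/-! ### Systems of flags and their gluings -/

namespace HeisenbergWeyl

/-- A system of flags: a finite set `W` of flags (the ends of lines that are attached to a vertex),
some of them heads and the others tails, a relation `joined t h` saying that the tail `t` and the
head `h` belong to the same line, and a relation `adj` saying that two flags sit at the same vertex.
No laws are imposed; the systems that matter are those of graphs, `Graph.flags`. -/
structure Flags where
  W : Type
  [finiteW : Finite W]
  isHead : W → Prop
  joined : W → W → Prop
  adj : W → W → Prop

namespace Flags

attribute [instance] Flags.finiteW

/-- The bijection `e` of flags transports the whole structure. -/
structure IsIso {X Y : Flags} (e : X.W ≃ Y.W) : Prop where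
  isHead : ∀ a, Y.isHead (e a) ↔ X.isHead a
  joined : ∀ a b, Y.joined (e a) (e b) ↔ X.joined a b
  adj : ∀ a b, Y.adj (e a) (e b) ↔ X.adj a b

/-- Two systems of flags are isomorphic. -/
def Iso (X Y : Flags) : Prop := ∃ e : X.W ≃ Y.W, IsIso e

variable {X Y Z X' Y' : Flags}

theorem IsIso.symm {e : X.W ≃ Y.W} (h : IsIso e) : IsIso e.symm where
  isHead a := by simp [← h.isHead]
  joined a b := by simp [← h.joined]
  adj a b := by simp [← h.adj]

theorem Iso.refl (X : Flags) : Iso X X :=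
  ⟨Equiv.refl _, fun _ => Iff.rfl, fun _ _ => Iff.rfl, fun _ _ => Iff.rfl⟩

theorem Iso.symm (h : Iso X Y) : Iso Y X := by
  obtain ⟨e, he⟩ := h
  exact ⟨e.symm, he.symm⟩

theorem Iso.trans (h : Iso X Y) (h' : Iso Y Z) : Iso X Z := by
  obtain ⟨e, he⟩ := h
  obtain ⟨f, hf⟩ := h'
  exact ⟨e.trans f, fun a => by simp [hf.isHead, he.isHead],
    fun a b => by simp [hf.joined, he.joined], fun a b => by simp [hf.adj, he.adj]⟩

/-- The flags in a subset, with the induced relations. -/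
def restrict (X : Flags) (S : Set X.W) : Flags where
  W := S
  isHead a := X.isHead a
  joined a b := X.joined a b
  adj a b := X.adj a b

theorem IsIso.restrict {e : X.W ≃ Y.W} (he : IsIso e) {S : Set X.W} {T : Set Y.W}
    (h : ∀ a, a ∈ S ↔ e a ∈ T) : Iso (X.restrict S) (Y.restrict T) :=
  ⟨e.subtypeEquiv h, fun a => he.isHead a.1, fun a b => he.joined a.1 b.1,
    fun a b => he.adj a.1 b.1⟩

theorem restrict_restrict (X : Flags) (S : Set X.W) (T : Set S) :
    Iso ((X.restrict S).restrict T) (X.restrict (Subtype.val '' T)) :=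
  ⟨Equiv.Set.image Subtype.val T Subtype.val_injective,
    fun _ => Iff.rfl, fun _ _ => Iff.rfl, fun _ _ => Iff.rfl⟩

theorem restrict_univ (X : Flags) : Iso (X.restrict Set.univ) X :=
  ⟨Equiv.Set.univ X.W, fun _ => Iff.rfl, fun _ _ => Iff.rfl, fun _ _ => Iff.rfl⟩

/-- A set of flags that is a union of lines. -/
def Closed (X : Flags) : Type := {S : Set X.W // ∀ a b, X.joined a b → (a ∈ S ↔ b ∈ S)}

instance (X : Flags) : Finite X.Closed := inferInstanceAs (Finite (Subtype _))

noncomputable instance (X : Flags) : Fintype X.Closed := Fintype.ofFinite _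

/-- The flags of the remaining lines. -/
def Closed.compl (S : X.Closed) : X.Closed :=
  ⟨S.1ᶜ, fun a b h => not_congr (S.2 a b h)⟩

/-- A matching in terms of flags: `rel x y` says that the line of the head `x` in `X`, whose tail is
free, is joined with the line of the tail `y` in `Y`, whose head is free. -/
@[ext] structure Gluing (X Y : Flags) where
  rel : X.W → Y.W → Prop
  isHead : ∀ x y, rel x y → X.isHead x
  isTail : ∀ x y, rel x y → ¬ Y.isHead y
  incoming : ∀ x y, rel x y → ∀ a, ¬ X.joined a x
  outgoing : ∀ x y, rel x y → ∀ b, ¬ Y.joined y b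
  left_inj : ∀ x y y', rel x y → rel x y' → y = y'
  right_inj : ∀ x x' y, rel x y → rel x' y → x = x'

instance (X Y : Flags) : Finite (Gluing X Y) :=
  Finite.of_injective Gluing.rel fun _ _ h => Gluing.ext h

noncomputable instance (X Y : Flags) : Fintype (Gluing X Y) := Fintype.ofFinite _

/-- The relation of belonging to the same line after gluing. -/
def glueJoined (G : Gluing X Y) : X.W ⊕ Y.W → X.W ⊕ Y.W → Prop
  | .inl a, .inl b => X.joined a b
  | .inr a, .inr b => Y.joined a b
  | .inr y, .inl x => G.rel x y
  | .inl _, .inr _ => False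

/-- The relation of sitting at the same vertex in a disjoint union. -/
def sumAdj (X Y : Flags) : X.W ⊕ Y.W → X.W ⊕ Y.W → Prop
  | .inl a, .inl b => X.adj a b
  | .inr a, .inr b => Y.adj a b
  | .inr _, .inl _ => False
  | .inl _, .inr _ => False

/-- The flags of a composite: the disjoint union of the flags, with the additional lines given by
the gluing. -/
def glue (G : Gluing X Y) : Flags where
  W := X.W ⊕ Y.W
  isHead := Sum.elim X.isHead Y.isHead
  joined := glueJoined G
  adj := sumAdj X Y

section
variable {e : X.W ≃ X'.W} {f : Y.W ≃ Y'.W}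

/-- Transport of gluings along isomorphisms. -/
def Gluing.map (he : IsIso e) (hf : IsIso f) (G : Gluing X Y) : Gluing X' Y' where
  rel x y := G.rel (e.symm x) (f.symm y)
  isHead x y h := by simpa [he.symm.isHead] using G.isHead _ _ h
  isTail x y h := by simpa [hf.symm.isHead] using G.isTail _ _ h
  incoming x y h a := by simpa [he.symm.joined] using G.incoming _ _ h (e.symm a)
  outgoing x y h a := by simpa [hf.symm.joined] using G.outgoing _ _ h (f.symm a)
  left_inj x y y' h h' := by simpa using G.left_inj _ _ _ h h'
  right_inj x x' y h h' := by simpa using G.right_inj _ _ _ h h'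

/-- Transport of gluings along isomorphisms, as a bijection. -/
def Gluing.mapEquiv (he : IsIso e) (hf : IsIso f) : Gluing X Y ≃ Gluing X' Y' where
  toFun := Gluing.map he hf
  invFun := Gluing.map he.symm hf.symm
  left_inv G := by ext; simp [Gluing.map]
  right_inv G := by ext; simp [Gluing.map]

theorem Gluing.glue_map (he : IsIso e) (hf : IsIso f) (G : Gluing X Y) :
    Iso (glue G) (glue (G.map he hf)) := by
  refine ⟨e.sumCongr f, ?_, ?_, ?_⟩
  · rintro (a | a)
    · exact he.isHead a
    · exact hf.isHead a
  · rintro (a | a) (b | b)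
    · exact he.joined a b
    · exact Iff.rfl
    · change G.rel (e.symm (e b)) (f.symm (f a)) ↔ G.rel b a
      simp
    · exact hf.joined a b
  · rintro (a | a) (b | b)
    · exact he.adj a b
    · exact Iff.rfl
    · exact Iff.rfl
    · exact hf.adj a b

end

/-- Both ways of bracketing a triple composition are described by the same data: relations between
each two of the three systems. -/
def Gluing.assocEquiv (X Y Z : Flags) :
    (Σ G : Gluing X Y, Gluing (glue G) Z) ≃ Σ H : Gluing Y Z, Gluing X (glue H) where
  toFun p :=
    ⟨{ rel := fun y z => p.2.rel (.inr y) z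
       isHead := fun y z h => p.2.isHead _ _ h
       isTail := fun y z h => p.2.isTail _ _ h
       incoming := fun y z h a => p.2.incoming _ _ h (.inr a)
       outgoing := fun y z h => p.2.outgoing _ _ h
       left_inj := fun y z z' h h' => p.2.left_inj _ _ _ h h'
       right_inj := fun y y' z h h' => Sum.inr_injective (p.2.right_inj _ _ _ h h') },
     { rel := fun x => Sum.elim (p.1.rel x) (p.2.rel (.inl x))
       isHead := by
        rintro x (y | z) h
        exacts [p.1.isHead _ _ h, p.2.isHead _ _ h]
       isTail := by
        rintro x (y | z) h
        exacts [p.1.isTail _ _ h, p.2.isTail _ _ h]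
       incoming := by
        rintro x (y | z) h a
        exacts [p.1.incoming _ _ h a, p.2.incoming _ _ h (.inl a)]
       outgoing := by
        rintro x (y | z) h (b | b) hb
        · exact p.1.outgoing _ _ h _ hb
        · exact hb
        · exact nomatch p.2.right_inj _ _ _ h hb
        · exact p.2.outgoing _ _ h _ hb
       left_inj := by
        rintro x (y | z) (y' | z') h h'
        · rw [p.1.left_inj _ _ _ h h']
        · exact (p.2.incoming _ _ h' (.inr y) h).elim
        · exact (p.2.incoming _ _ h (.inr y') h').elim
        · rw [p.2.left_inj _ _ _ h h']
       right_inj := by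
        rintro x x' (y | z) h h'
        · exact p.1.right_inj _ _ _ h h'
        · exact Sum.inl_injective (p.2.right_inj _ _ _ h h') }⟩
  invFun p :=
    ⟨{ rel := fun x y => p.2.rel x (.inl y)
       isHead := fun x y h => p.2.isHead _ _ h
       isTail := fun x y h => p.2.isTail _ _ h
       incoming := fun x y h => p.2.incoming _ _ h
       outgoing := fun x y h b => p.2.outgoing _ _ h (.inl b)
       left_inj := fun x y y' h h' => Sum.inl_injective (p.2.left_inj _ _ _ h h')
       right_inj := fun x x' y h h' => p.2.right_inj _ _ _ h h' },
     { rel := Sum.elim (fun x z => p.2.rel x (.inr z)) p.1.rel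
       isHead := by
        rintro (x | y) z h
        exacts [p.2.isHead _ _ h, p.1.isHead _ _ h]
       isTail := by
        rintro (x | y) z h
        exacts [p.2.isTail _ _ h, p.1.isTail _ _ h]
       incoming := by
        rintro (x | y) z h (a | a) ha
        · exact p.2.incoming _ _ h _ ha
        · exact nomatch p.2.left_inj _ _ _ h ha
        · exact ha
        · exact p.1.incoming _ _ h _ ha
       outgoing := by
        rintro (x | y) z h b
        exacts [p.2.outgoing _ _ h (.inr b), p.1.outgoing _ _ h b]
       left_inj := by
        rintro (x | y) z z' h h'
        · exact Sum.inr_injective (p.2.left_inj _ _ _ h h')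
        · exact p.1.left_inj _ _ _ h h'
       right_inj := by
        rintro (x | y) (x' | y') z h h'
        · rw [p.2.right_inj _ _ _ h h']
        · exact (p.2.outgoing _ _ h (.inl y') h').elim
        · exact (p.2.outgoing _ _ h' (.inl y) h).elim
        · rw [p.1.right_inj _ _ _ h h'] }⟩
  left_inv := by
    rintro ⟨G, H⟩
    refine Sigma.ext rfl (heq_of_eq (Gluing.ext ?_))
    funext a z
    rcases a with a | a <;> rfl
  right_inv := by
    rintro ⟨G, H⟩
    refine Sigma.ext rfl (heq_of_eq (Gluing.ext ?_))
    funext x a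
    rcases a with a | a <;> rfl

theorem Gluing.glue_assoc (p : Σ G : Gluing X Y, Gluing (glue G) Z) :
    Iso (glue p.2) (glue (Gluing.assocEquiv X Y Z p).2) := by
  refine ⟨Equiv.sumAssoc _ _ _, ?_, ?_, ?_⟩
  · rintro ((a | a) | a) <;> rfl
  · rintro ((a | a) | a) ((b | b) | b) <;> rfl
  · rintro ((a | a) | a) ((b | b) | b) <;> rfl

end Flags
end HeisenbergWeyl

namespace HeisenbergWeyl
namespace Flags
variable {X Y : Flags}

/-- Every line created by the gluing lies either in `A` and `B` or in their complements. -/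
def Gluing.Respects (G : Gluing X Y) (A : Set X.W) (B : Set Y.W) : Prop :=
  ∀ x y, G.rel x y → (x ∈ A ↔ y ∈ B)

/-- The part of a gluing between two subsets. -/
def Gluing.restrict (G : Gluing X Y) (A : Set X.W) (B : Set Y.W) :
    Gluing (X.restrict A) (Y.restrict B) where
  rel x y := G.rel x.1 y.1
  isHead _ _ h := G.isHead _ _ h
  isTail _ _ h := G.isTail _ _ h
  incoming _ _ h a := G.incoming _ _ h a.1
  outgoing _ _ h b := G.outgoing _ _ h b.1
  left_inj _ _ _ h h' := Subtype.ext (G.left_inj _ _ _ h h')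
  right_inj _ _ _ h h' := Subtype.ext (G.right_inj _ _ _ h h')

theorem Gluing.glue_restrict (G : Gluing X Y) (C : Set (X.W ⊕ Y.W)) :
    Iso ((glue G).restrict C) (glue (G.restrict (Sum.inl ⁻¹' C) (Sum.inr ⁻¹' C))) := by
  refine ⟨Equiv.subtypeSum, ?_, ?_, ?_⟩
  · rintro ⟨a | a, ha⟩ <;> rfl
  · rintro ⟨a | a, ha⟩ ⟨b | b, hb⟩ <;> rfl
  · rintro ⟨a | a, ha⟩ ⟨b | b, hb⟩ <;> rfl

/-- A union of lines in a composite consists of a union of lines in each factor, such that the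
gluing joins no line of these with another one. -/
def closedGlueEquiv (X Y : Flags) : (Σ G : Gluing X Y, (glue G).Closed) ≃
    Σ p : X.Closed × Y.Closed, {G : Gluing X Y // G.Respects p.1.1 p.2.1} where
  toFun q :=
    ⟨(⟨Sum.inl ⁻¹' q.2.1, fun a b h => q.2.2 (.inl a) (.inl b) h⟩,
      ⟨Sum.inr ⁻¹' q.2.1, fun a b h => q.2.2 (.inr a) (.inr b) h⟩),
      ⟨q.1, fun x y h => (q.2.2 (.inr y) (.inl x) h).symm⟩⟩
  invFun q :=
    ⟨q.2.1, {w | Sum.elim (· ∈ q.1.1.1) (· ∈ q.1.2.1) w}, by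
      rintro (a | a) (b | b) h
      · exact q.1.1.2 a b h
      · exact h.elim
      · exact (q.2.2 b a h).symm
      · exact q.1.2.2 a b h⟩
  left_inv := by
    rintro ⟨G, C⟩
    refine Sigma.ext rfl (heq_of_eq (Subtype.ext ?_))
    ext (w | w) <;> rfl
  right_inv := by
    rintro ⟨⟨A, B⟩, G⟩
    rfl

/-- A gluing that respects unions of lines `A` and `B` is given by a gluing between `A` and `B`
together with one between their complements. -/
def Gluing.splitEquiv (A : X.Closed) (B : Y.Closed) :
    {G : Gluing X Y // G.Respects A.1 B.1} ≃
      Gluing (X.restrict A.1) (Y.restrict B.1) ×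
        Gluing (X.restrict A.compl.1) (Y.restrict B.compl.1) where
  toFun G := (G.1.restrict _ _, G.1.restrict _ _)
  invFun p :=
    ⟨{ rel := fun x y => (∃ hx hy, p.1.rel ⟨x, hx⟩ ⟨y, hy⟩) ∨ ∃ hx hy, p.2.rel ⟨x, hx⟩ ⟨y, hy⟩
       isHead := by
        rintro x y (⟨hx, hy, h⟩ | ⟨hx, hy, h⟩)
        exacts [p.1.isHead _ _ h, p.2.isHead _ _ h]
       isTail := by
        rintro x y (⟨hx, hy, h⟩ | ⟨hx, hy, h⟩)
        exacts [p.1.isTail _ _ h, p.2.isTail _ _ h]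
       incoming := by
        rintro x y (⟨hx, hy, h⟩ | ⟨hx, hy, h⟩) a ha
        exacts [p.1.incoming _ _ h ⟨a, (A.2 _ _ ha).2 hx⟩ ha,
          p.2.incoming _ _ h ⟨a, (A.compl.2 _ _ ha).2 hx⟩ ha]
       outgoing := by
        rintro x y (⟨hx, hy, h⟩ | ⟨hx, hy, h⟩) b hb
        exacts [p.1.outgoing _ _ h ⟨b, (B.2 _ _ hb).1 hy⟩ hb,
          p.2.outgoing _ _ h ⟨b, (B.compl.2 _ _ hb).1 hy⟩ hb]
       left_inj := by
        rintro x y y' (⟨hx, hy, h⟩ | ⟨hx, hy, h⟩) (⟨hx', hy', h'⟩ | ⟨hx', hy', h'⟩)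
        · exact congrArg Subtype.val (p.1.left_inj _ _ _ h h')
        · exact (hx' hx).elim
        · exact (hx hx').elim
        · exact congrArg Subtype.val (p.2.left_inj _ _ _ h h')
       right_inj := by
        rintro x x' y (⟨hx, hy, h⟩ | ⟨hx, hy, h⟩) (⟨hx', hy', h'⟩ | ⟨hx', hy', h'⟩)
        · exact congrArg Subtype.val (p.1.right_inj _ _ _ h h')
        · exact (hy' hy).elim
        · exact (hy hy').elim
        · exact congrArg Subtype.val (p.2.right_inj _ _ _ h h') }, by
      rintro x y (⟨hx, hy, h⟩ | ⟨hx, hy, h⟩)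
      · exact iff_of_true hx hy
      · exact iff_of_false hx hy⟩
  left_inv := by
    rintro ⟨G, hG⟩
    refine Subtype.ext (Gluing.ext ?_)
    funext x y
    refine propext ⟨?_, fun h => ?_⟩
    · rintro (⟨hx, hy, h⟩ | ⟨hx, hy, h⟩) <;> exact h
    · by_cases hx : x ∈ A.1
      · exact .inl ⟨hx, (hG x y h).1 hx, h⟩
      · exact .inr ⟨hx, fun hy => hx ((hG x y h).2 hy), h⟩
  right_inv := by
    rintro ⟨G, G'⟩
    refine Prod.ext (Gluing.ext ?_) (Gluing.ext ?_) <;> funext x y <;>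
      refine propext ⟨?_, fun h => ?_⟩
    · rintro (⟨hx, hy, h⟩ | ⟨hx, hy, h⟩)
      exacts [h, (hx x.2).elim]
    · exact .inl ⟨x.2, y.2, h⟩
    · rintro (⟨hx, hy, h⟩ | ⟨hx, hy, h⟩)
      exacts [(x.2 hx).elim, h]
    · exact .inr ⟨x.2, y.2, h⟩

end Flags

/-! ### The flags of a graph -/

namespace Graph

open Flags

/-- The head (for `true`) or the tail (for `false`) of a line. -/
def endAt (Γ : Graph) (e : Γ.E) : Bool → Option Γ.V
  | true => Γ.head e
  | false => Γ.tail e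

/-- The flags of a graph: its attached ends of lines. -/
def flags (Γ : Graph) : Flags where
  W := {p : Γ.E × Bool // Γ.endAt p.1 p.2 ≠ none}
  isHead x := x.1.2 = true
  joined x y := x.1.1 = y.1.1 ∧ x.1.2 = false ∧ y.1.2 = true
  adj x y := Γ.endAt x.1.1 x.1.2 = Γ.endAt y.1.1 y.1.2

variable {Γ Γ' Γ₂ Γ₁ : Graph}

/-- The line of a flag. -/
def line (x : Γ.flags.W) : Γ.E := x.1.1

/-- Whether a flag is a head (`true`) or a tail (`false`). -/
def sign (x : Γ.flags.W) : Bool := x.1.2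

/-- A flag is determined by its line and by whether it is a head. -/
theorem flag_ext {x y : Γ.flags.W} (h : line x = line y) (h' : sign x = sign y) : x = y :=
  Subtype.ext (Prod.ext h h')

theorem line_surjective (Γ : Graph) : Function.Surjective (line (Γ := Γ)) := by
  intro e
  rcases Γ.attached e with h | h
  · exact ⟨⟨(e, true), h⟩, rfl⟩
  · exact ⟨⟨(e, false), h⟩, rfl⟩

/-- Two flags of a line are equal or joined. -/
theorem line_eq_iff {x y : Γ.flags.W} :
    line x = line y ↔ x = y ∨ Γ.flags.joined x y ∨ Γ.flags.joined y x := by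
  constructor
  · rcases x with ⟨⟨e, b⟩, hx⟩
    rcases y with ⟨⟨f, c⟩, hy⟩
    rintro (rfl : e = f)
    cases b <;> cases c
    · exact .inl rfl
    · exact .inr (.inl ⟨rfl, rfl, rfl⟩)
    · exact .inr (.inr ⟨rfl, rfl, rfl⟩)
    · exact .inl rfl
  · rintro (rfl | h | h)
    exacts [rfl, h.1, h.1.symm]

/-- The vertex of a flag. -/
def vertex (x : Γ.flags.W) : Γ.V := (Γ.endAt x.1.1 x.1.2).get (Option.isSome_iff_ne_none.2 x.2)

theorem endAt_line (x : Γ.flags.W) : Γ.endAt (line x) (sign x) = some (vertex x) := by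
  simp [line, sign, vertex]

theorem endAt_line_ne_none (x : Γ.flags.W) : Γ.endAt (line x) (sign x) ≠ none := x.2

theorem vertex_surjective (Γ : Graph) : Function.Surjective (vertex (Γ := Γ)) := by
  intro v
  obtain ⟨e, h | h⟩ := Γ.covered v
  · refine ⟨⟨(e, true), by simp [endAt, h]⟩, by simp [vertex, endAt, h]⟩
  · refine ⟨⟨(e, false), by simp [endAt, h]⟩, by simp [vertex, endAt, h]⟩

theorem vertex_eq_iff {x y : Γ.flags.W} : vertex x = vertex y ↔ Γ.flags.adj x y := by
  change _ ↔ Γ.endAt (line x) (sign x) = Γ.endAt (line y) (sign y)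
  rw [endAt_line, endAt_line, Option.some_inj]

end Graph

/-- A bijection that is compatible with two surjections descends to their targets. -/
theorem exists_equiv_of_surjective {α α' β β' : Type*} {p : α → β} {p' : α' → β'}
    (hp : Function.Surjective p) (hp' : Function.Surjective p') (e : α ≃ α')
    (h : ∀ a b, p' (e a) = p' (e b) ↔ p a = p b) :
    ∃ f : β ≃ β', ∀ a, f (p a) = p' (e a) := by
  let f : β → β' := fun b => p' (e (hp b).choose)
  have hf : ∀ a, f (p a) = p' (e a) := fun a => (h _ _).2 (hp (p a)).choose_spec
  refine ⟨Equiv.ofBijective f ⟨?_, ?_⟩, hf⟩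
  · intro b c hbc
    obtain ⟨a, rfl⟩ := hp b
    obtain ⟨a', rfl⟩ := hp c
    rw [hf, hf] at hbc
    exact (h _ _).1 hbc
  · intro b
    obtain ⟨a, rfl⟩ := hp' b
    exact ⟨p (e.symm a), by simp [hf]⟩

namespace Graph
open Flags
variable {Γ Γ' Γ₂ Γ₁ : Graph}

/-- A graph is determined by its flags, since every line and every vertex carries a flag. -/
theorem equivalent_iff_iso : Equivalent Γ Γ' ↔ Iso Γ.flags Γ'.flags := by
  constructor
  · rintro ⟨a, v, hh, ht⟩
    have key : ∀ e b, Γ'.endAt (a e) b = (Γ.endAt e b).map v := by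
      rintro e (_ | _)
      exacts [ht e, hh e]
    refine ⟨(a.prodCongr (Equiv.refl Bool)).subtypeEquiv fun p => by simp [key], ?_, ?_, ?_⟩
    · exact fun x => Iff.rfl
    · exact fun x y => and_congr_left fun _ => a.apply_eq_iff_eq
    · intro x y
      change Γ'.endAt (a x.1.1) x.1.2 = Γ'.endAt (a y.1.1) y.1.2 ↔ _
      rw [key, key]
      exact (Option.map_injective v.injective).eq_iff
  · rintro ⟨e, he⟩
    obtain ⟨a, ha⟩ := exists_equiv_of_surjective Γ.line_surjective Γ'.line_surjective e
      fun x y => by rw [line_eq_iff, line_eq_iff, he.joined, he.joined, e.apply_eq_iff_eq]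
    obtain ⟨v, hv⟩ := exists_equiv_of_surjective Γ.vertex_surjective Γ'.vertex_surjective e
      fun x y => by rw [vertex_eq_iff, vertex_eq_iff, he.adj]
    have hsign : ∀ x, sign (e x) = sign x := fun x => Bool.eq_iff_iff.2 (he.isHead x)
    have key : ∀ l b, Γ'.endAt (a l) b = (Γ.endAt l b).map v := by
      intro l b
      by_cases h : Γ.endAt l b = none
      · rw [h, Option.map_none]
        by_contra h'
        obtain ⟨x, hx⟩ := e.surjective ⟨(a l, b), h'⟩
        have h1 : line x = l := a.injective (by rw [ha, hx]; rfl)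
        have h2 : sign x = b := by rw [← hsign, hx]; rfl
        exact x.2 (by rw [← h1, ← h2] at h; exact h)
      · obtain ⟨w, rfl, rfl⟩ : ∃ w : Γ.flags.W, line w = l ∧ sign w = b := ⟨⟨(l, b), h⟩, rfl, rfl⟩
        rw [endAt_line, ha, ← hsign, endAt_line, Option.map_some, hv]
    exact ⟨a, v, fun l => key l true, fun l => key l false⟩

theorem diagram_eq_iff : Γ.diagram = Γ'.diagram ↔ Iso Γ.flags Γ'.flags :=
  Quotient.eq.trans equivalent_iff_iso

theorem isEmpty_flags_iff : IsEmpty Γ.flags.W ↔ IsEmpty Γ.E :=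
  ⟨fun _ => Γ.line_surjective.isEmpty, fun h => ⟨fun x => h.elim (line x)⟩⟩

theorem diagram_eq_void_iff : Γ.diagram = Diagram.void ↔ IsEmpty Γ.E := by
  change Γ.diagram = empty.diagram ↔ _
  rw [diagram_eq_iff, ← isEmpty_flags_iff]
  have : IsEmpty empty.flags.W := isEmpty_flags_iff.2 (inferInstanceAs (IsEmpty Empty))
  refine ⟨fun ⟨e, _⟩ => e.isEmpty, fun h => ⟨Equiv.equivOfIsEmpty _ _, ?_, ?_, ?_⟩⟩ <;>
    exact fun x => h.elim x

/-- The flags of a restriction are the flags of the lines in `A`. -/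
theorem exists_isIso_flags_restrict (A : Set Γ.E) :
    ∃ e : (Γ.restrict A).flags.W ≃ (Γ.flags.restrict (line ⁻¹' A)).W,
      IsIso e ∧ ∀ x, line (Subtype.val (e x)) = Subtype.val (line x) := by
  have hend : ∀ (e : (Γ.restrict A).E) b,
      ((Γ.restrict A).endAt e b).map Subtype.val = Γ.endAt (Subtype.val e) b := by
    rintro e (_ | _) <;> simp [endAt, restrict, Option.map_pmap]
  have hnone : ∀ (e : (Γ.restrict A).E) b,
      (Γ.restrict A).endAt e b = none ↔ Γ.endAt (Subtype.val e) b = none := by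
    intro e b
    rw [← hend]
    exact Option.map_eq_none_iff.symm
  refine ⟨⟨fun x => ⟨⟨(x.1.1.1, x.1.2), mt (hnone _ _).2 x.2⟩, x.1.1.2⟩,
    fun x => ⟨(⟨x.1.1.1, x.2⟩, x.1.1.2), mt (hnone ⟨x.1.1.1, x.2⟩ _).1 x.1.2⟩,
    fun _ => rfl, fun _ => rfl⟩, ⟨fun x => Iff.rfl, fun x y => ?_, fun x y => ?_⟩, fun _ => rfl⟩
  · exact and_congr_left fun _ => Subtype.ext_iff.symm
  · change Γ.endAt (Subtype.val x.1.1) x.1.2 = Γ.endAt (Subtype.val y.1.1) y.1.2 ↔ _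
    rw [← hend, ← hend]
    exact (Option.map_injective Subtype.val_injective).eq_iff

theorem flags_restrict (A : Set Γ.E) :
    Iso (Γ.restrict A).flags (Γ.flags.restrict (line ⁻¹' A)) :=
  let ⟨e, he, _⟩ := exists_isIso_flags_restrict A
  ⟨e, he⟩

theorem flags_restrict_restrict (A : Set Γ.E) (B : Set (Γ.restrict A).E) :
    Iso ((Γ.restrict A).restrict B).flags (Γ.restrict (Subtype.val '' B)).flags := by
  obtain ⟨e, he, hline⟩ := exists_isIso_flags_restrict A
  let T : Set (Γ.flags.restrict (line ⁻¹' A)).W := {x | ∃ b ∈ B, b.1 = line x.1}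
  have hT : Subtype.val '' T = line ⁻¹' (Subtype.val '' B) := by
    ext x
    constructor
    · rintro ⟨y, hy, rfl⟩
      exact hy
    · rintro ⟨b, hb, hbx⟩
      have hx : line x ∈ A := by rw [← hbx]; exact b.2
      exact ⟨⟨x, hx⟩, ⟨b, hb, hbx⟩, rfl⟩
  have h : Iso ((Γ.restrict A).flags.restrict (line ⁻¹' B))
      ((Γ.flags.restrict (line ⁻¹' A)).restrict T) := by
    refine he.restrict fun x => ⟨fun hx => ⟨_, hx, (hline x).symm⟩, ?_⟩
    rintro ⟨b, hb, hbx⟩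
    have hb' : b = line x := Subtype.ext (hbx.trans (hline x))
    exact show line x ∈ B from hb' ▸ hb
  have h' := h.trans (restrict_restrict _ _ _)
  rw [hT] at h'
  exact (flags_restrict B).trans (h'.trans (flags_restrict _).symm)

theorem flags_restrict_univ (Γ : Graph) : Iso (Γ.restrict Set.univ).flags Γ.flags :=
  (flags_restrict _).trans Γ.flags.restrict_univ

/-- Sets of lines are the same as unions of lines in the system of flags. -/
noncomputable def closedEquiv (Γ : Graph) : Set Γ.E ≃ Γ.flags.Closed :=
  Equiv.ofBijective (fun A => ⟨line ⁻¹' A, fun a b h => by rw [Set.mem_preimage, Set.mem_preimage,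
    line_eq_iff.2 (.inr (.inl h))]⟩) ⟨by
    intro A B h
    exact Γ.line_surjective.preimage_injective (congrArg Subtype.val h), by
    rintro ⟨S, hS⟩
    refine ⟨line '' S, Subtype.ext (Set.Subset.antisymm ?_ (Set.subset_preimage_image _ _))⟩
    rintro x ⟨y, hy, hxy⟩
    rcases line_eq_iff.1 hxy with rfl | h | h
    exacts [hy, (hS _ _ h).1 hy, (hS _ _ h).2 hy]⟩

end Graph
end HeisenbergWeyl

/-! ### The flags of a composite -/

namespace HeisenbergWeyl
namespace Graph
open Flags

variable {Γ₂ Γ₁ : Graph} (m : Matching Γ₂ Γ₁)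

open Classical in
/-- The line of the composite that contains a given line of the upper factor. -/
noncomputable def upperLine (e : Γ₂.E) : (compose m).E :=
  if h : ∃ p ∈ m.pairs, p.1 = e then .inr (.inr ⟨h.choose, h.choose_spec.1⟩)
  else .inl ⟨e, fun p hp hpe => h ⟨p, hp, hpe⟩⟩

open Classical in
/-- The line of the composite that contains a given line of the lower factor. -/
noncomputable def lowerLine (e : Γ₁.E) : (compose m).E :=
  if h : ∃ p ∈ m.pairs, p.2 = e then .inr (.inr ⟨h.choose, h.choose_spec.1⟩)
  else .inr (.inl ⟨e, fun p hp hpe => h ⟨p, hp, hpe⟩⟩)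

variable {m}

theorem upperLine_of_mem {p : Γ₂.E × Γ₁.E} (hp : p ∈ m.pairs) :
    upperLine m p.1 = .inr (.inr ⟨p, hp⟩) := by
  have h : ∃ q ∈ m.pairs, q.1 = p.1 := ⟨p, hp, rfl⟩
  refine (dif_pos h).trans ?_
  exact congrArg (Sum.inr ∘ Sum.inr)
    (Subtype.ext (m.fst_inj _ h.choose_spec.1 _ hp h.choose_spec.2))

theorem lowerLine_of_mem {p : Γ₂.E × Γ₁.E} (hp : p ∈ m.pairs) :
    lowerLine m p.2 = .inr (.inr ⟨p, hp⟩) := by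
  have h : ∃ q ∈ m.pairs, q.2 = p.2 := ⟨p, hp, rfl⟩
  refine (dif_pos h).trans ?_
  exact congrArg (Sum.inr ∘ Sum.inr)
    (Subtype.ext (m.snd_inj _ h.choose_spec.1 _ hp h.choose_spec.2))

theorem upperLine_of_unmatched {e : Γ₂.E} (h : ∀ p ∈ m.pairs, p.1 ≠ e) :
    upperLine m e = .inl ⟨e, h⟩ :=
  dif_neg fun ⟨p, hp, hpe⟩ => h p hp hpe

theorem lowerLine_of_unmatched {e : Γ₁.E} (h : ∀ p ∈ m.pairs, p.2 ≠ e) :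
    lowerLine m e = .inr (.inl ⟨e, h⟩) :=
  dif_neg fun ⟨p, hp, hpe⟩ => h p hp hpe

theorem matched_or_unmatched_upper (m : Matching Γ₂ Γ₁) (e : Γ₂.E) :
    (∃ p ∈ m.pairs, p.1 = e) ∨ ∀ p ∈ m.pairs, p.1 ≠ e := by
  by_contra! h
  obtain ⟨p, hp, hpe⟩ := h.2
  exact h.1 p hp hpe

theorem matched_or_unmatched_lower (m : Matching Γ₂ Γ₁) (e : Γ₁.E) :
    (∃ p ∈ m.pairs, p.2 = e) ∨ ∀ p ∈ m.pairs, p.2 ≠ e := by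
  by_contra! h
  obtain ⟨p, hp, hpe⟩ := h.2
  exact h.1 p hp hpe

theorem upperLine_injective : Function.Injective (upperLine m) := by
  intro e f h
  obtain ⟨p, hp, rfl⟩ | he := matched_or_unmatched_upper m e <;>
    obtain ⟨q, hq, rfl⟩ | hf := matched_or_unmatched_upper m f
  · rw [upperLine_of_mem hp, upperLine_of_mem hq] at h
    cases h
    rfl
  · rw [upperLine_of_mem hp, upperLine_of_unmatched hf] at h
    cases h
  · rw [upperLine_of_mem hq, upperLine_of_unmatched he] at h
    cases h
  · rw [upperLine_of_unmatched he, upperLine_of_unmatched hf] at h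
    cases h
    rfl

theorem lowerLine_injective : Function.Injective (lowerLine m) := by
  intro e f h
  obtain ⟨p, hp, rfl⟩ | he := matched_or_unmatched_lower m e <;>
    obtain ⟨q, hq, rfl⟩ | hf := matched_or_unmatched_lower m f
  · rw [lowerLine_of_mem hp, lowerLine_of_mem hq] at h
    cases h
    rfl
  · rw [lowerLine_of_mem hp, lowerLine_of_unmatched hf] at h
    cases h
  · rw [lowerLine_of_mem hq, lowerLine_of_unmatched he] at h
    cases h
  · rw [lowerLine_of_unmatched he, lowerLine_of_unmatched hf] at h
    cases h
    rfl

theorem upperLine_eq_lowerLine_iff {e : Γ₂.E} {f : Γ₁.E} :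
    upperLine m e = lowerLine m f ↔ (e, f) ∈ m.pairs := by
  constructor
  · intro h
    obtain ⟨p, hp, rfl⟩ | he := matched_or_unmatched_upper m e <;>
      obtain ⟨q, hq, rfl⟩ | hf := matched_or_unmatched_lower m f
    · rw [upperLine_of_mem hp, lowerLine_of_mem hq] at h
      cases h
      exact hp
    · rw [upperLine_of_mem hp, lowerLine_of_unmatched hf] at h
      cases h
    · rw [lowerLine_of_mem hq, upperLine_of_unmatched he] at h
      cases h
    · rw [upperLine_of_unmatched he, lowerLine_of_unmatched hf] at h
      cases h
  · intro h
    rw [upperLine_of_mem h, lowerLine_of_mem h]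

theorem endAt_upperLine {e : Γ₂.E} {b : Bool} (h : Γ₂.endAt e b ≠ none) :
    (compose m).endAt (upperLine m e) b = (Γ₂.endAt e b).map Sum.inl := by
  obtain ⟨p, hp, rfl⟩ | he := matched_or_unmatched_upper m e
  · rw [upperLine_of_mem hp]
    cases b
    · exact (h (m.incoming p hp)).elim
    · rfl
  · rw [upperLine_of_unmatched he]
    cases b <;> rfl

theorem endAt_lowerLine {e : Γ₁.E} {b : Bool} (h : Γ₁.endAt e b ≠ none) :
    (compose m).endAt (lowerLine m e) b = (Γ₁.endAt e b).map Sum.inr := by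
  obtain ⟨p, hp, rfl⟩ | he := matched_or_unmatched_lower m e
  · rw [lowerLine_of_mem hp]
    cases b
    · rfl
    · exact (h (m.outgoing p hp)).elim
  · rw [lowerLine_of_unmatched he]
    cases b <;> rfl

/-- The flags of a matched line of the upper factor are heads. -/
theorem isHead_of_mem {x : Γ₂.flags.W} {f : Γ₁.E} (h : (line x, f) ∈ m.pairs) :
    sign x = true := by
  obtain ⟨⟨e, b⟩, hx⟩ := x
  cases b
  · exact (hx (m.incoming _ h)).elim
  · rfl

/-- The flags of a matched line of the lower factor are tails. -/
theorem isTail_of_mem {y : Γ₁.flags.W} {e : Γ₂.E} (h : (e, line y) ∈ m.pairs) :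
    sign y = false := by
  obtain ⟨⟨e, b⟩, hy⟩ := y
  cases b
  · rfl
  · exact (hy (m.outgoing _ h)).elim

/-- The gluing of flags that corresponds to a matching. -/
def gluing (m : Matching Γ₂ Γ₁) : Gluing Γ₂.flags Γ₁.flags where
  rel x y := (line x, line y) ∈ m.pairs
  isHead _ _ h := isHead_of_mem h
  isTail _ y h := show ¬ sign y = true by simp [isTail_of_mem h]
  incoming x y h a ha := by
    have h' : (line a, line y) ∈ m.pairs := by rwa [show line a = line x from ha.1]
    exact Bool.false_ne_true (ha.2.1.symm.trans (isHead_of_mem h'))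
  outgoing x y h b hb := by
    have h' : (line x, line b) ∈ m.pairs := by rwa [← show line y = line b from hb.1]
    exact Bool.false_ne_true ((isTail_of_mem h').symm.trans hb.2.2)
  left_inj _ _ _ h h' := flag_ext (congrArg Prod.snd (m.fst_inj _ h _ h' rfl))
    ((isTail_of_mem h).trans (isTail_of_mem h').symm)
  right_inj x x' _ h h' := by
    have hl : line x = line x' := (Prod.mk.inj (m.snd_inj _ h _ h' rfl)).1
    exact flag_ext hl ((isHead_of_mem h).trans (isHead_of_mem h').symm)

theorem gluing_bijective : Function.Bijective (gluing (Γ₂ := Γ₂) (Γ₁ := Γ₁)) := by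
  constructor
  · intro m m' h
    ext ⟨e, f⟩
    obtain ⟨x, rfl⟩ := Γ₂.line_surjective e
    obtain ⟨y, rfl⟩ := Γ₁.line_surjective f
    exact iff_of_eq (congrFun (congrFun (congrArg Gluing.rel h) x) y)
  · intro G
    -- A flag taking part in `G` is the only one on its line, since the other end is free.
    have hx : ∀ {x y}, G.rel x y → ∀ x', line x' = line x → x' = x := by
      intro x y h x' hx'
      rcases line_eq_iff.1 hx' with h' | h' | h'
      · exact h'
      · exact (G.incoming _ _ h _ h').elim
      · exact (Bool.false_ne_true (h'.2.1.symm.trans (G.isHead _ _ h))).elim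
    have hy : ∀ {x y}, G.rel x y → ∀ y', line y' = line y → y' = y := by
      intro x y h y' hy'
      rcases line_eq_iff.1 hy' with h' | h' | h'
      · exact h'
      · exact (G.isTail _ _ h h'.2.2).elim
      · exact (G.outgoing _ _ h _ h').elim
    have hfree₂ : ∀ {x y}, G.rel x y → Γ₂.tail (line x) = none := by
      intro x y h
      by_contra h'
      have := hx h ⟨(line x, false), h'⟩ rfl
      exact Bool.false_ne_true ((congrArg sign this).trans (G.isHead _ _ h))
    have hfree₁ : ∀ {x y}, G.rel x y → Γ₁.head (line y) = none := by
      intro x y h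
      by_contra h'
      have := hy h ⟨(line y, true), h'⟩ rfl
      exact G.isTail _ _ h (congrArg sign this).symm
    refine ⟨{ pairs := {p | ∃ x y, G.rel x y ∧ line x = p.1 ∧ line y = p.2}
              incoming := ?_, outgoing := ?_, fst_inj := ?_, snd_inj := ?_ }, ?_⟩
    · rintro ⟨_, _⟩ ⟨x, y, h, rfl, rfl⟩
      exact hfree₂ h
    · rintro ⟨_, _⟩ ⟨x, y, h, rfl, rfl⟩
      exact hfree₁ h
    · rintro ⟨_, _⟩ ⟨x, y, h, rfl, rfl⟩ ⟨_, _⟩ ⟨x', y', h', rfl, rfl⟩ hxx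
      obtain rfl := hx h' _ hxx
      rw [G.left_inj _ _ _ h h']
    · rintro ⟨_, _⟩ ⟨x, y, h, rfl, rfl⟩ ⟨_, _⟩ ⟨x', y', h', rfl, rfl⟩ hyy
      obtain rfl := hy h' _ hyy
      rw [G.right_inj _ _ _ h h']
    · ext x y
      constructor
      · rintro ⟨x', y', h, hx', hy'⟩
        rwa [hx h x hx'.symm, hy h y hy'.symm]
      · exact fun h => ⟨x, y, h, rfl, rfl⟩

/-- The flags of a composite. -/
theorem flags_compose (m : Matching Γ₂ Γ₁) : Iso (glue (gluing m)) (compose m).flags := by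
  let f : Γ₂.flags.W ⊕ Γ₁.flags.W → (compose m).flags.W := Sum.elim
    (fun x => ⟨(upperLine m (line x), sign x), fun h => x.2 (Option.map_eq_none_iff.1
      ((endAt_upperLine (endAt_line_ne_none x)).symm.trans h))⟩)
    (fun y => ⟨(lowerLine m (line y), sign y), fun h => y.2 (Option.map_eq_none_iff.1
      ((endAt_lowerLine (endAt_line_ne_none y)).symm.trans h))⟩)
  have hend₂ : ∀ x, (compose m).endAt (f (.inl x)).1.1 (f (.inl x)).1.2 =
      some (Sum.inl (vertex x)) := fun x =>
    (endAt_upperLine x.2).trans (congrArg (Option.map Sum.inl) (endAt_line x))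
  have hend₁ : ∀ y, (compose m).endAt (f (.inr y)).1.1 (f (.inr y)).1.2 =
      some (Sum.inr (vertex y)) := fun y =>
    (endAt_lowerLine y.2).trans (congrArg (Option.map Sum.inr) (endAt_line y))
  have hf : Function.Bijective f := by
    constructor
    · rintro (x | x) (y | y) h
      · have h1 := congrArg line h
        have h2 := congrArg sign h
        exact congrArg _ (flag_ext (upperLine_injective h1) h2)
      · have h1 := congrArg line h
        have h2 : sign x = sign y := congrArg sign h
        have h3 := upperLine_eq_lowerLine_iff.1 h1
        exact (Bool.false_ne_true ((isTail_of_mem h3).symm.trans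
          (h2.symm.trans (isHead_of_mem h3)))).elim
      · have h1 := congrArg line h
        have h2 : sign x = sign y := congrArg sign h
        have h3 := upperLine_eq_lowerLine_iff.1 h1.symm
        exact (Bool.false_ne_true ((isTail_of_mem h3).symm.trans
          (h2.trans (isHead_of_mem h3)))).elim
      · have h1 := congrArg line h
        have h2 := congrArg sign h
        exact congrArg _ (flag_ext (lowerLine_injective h1) h2)
    · have upper : ∀ (e : Γ₂.E) (b : Bool) (h : Γ₂.endAt e b ≠ none) (w : (compose m).flags.W),
          upperLine m e = line w → sign w = b → ∃ x, f x = w := by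
        rintro e b h w hw rfl
        exact ⟨.inl ⟨(e, sign w), h⟩, flag_ext hw rfl⟩
      have lower : ∀ (e : Γ₁.E) (b : Bool) (h : Γ₁.endAt e b ≠ none) (w : (compose m).flags.W),
          lowerLine m e = line w → sign w = b → ∃ x, f x = w := by
        rintro e b h w hw rfl
        exact ⟨.inr ⟨(e, sign w), h⟩, flag_ext hw rfl⟩
      rintro ⟨⟨e | e | p, b⟩, hw⟩
      · refine upper e.1 b (fun h => hw ?_) _ (upperLine_of_unmatched e.2) rfl
        cases b <;> exact congrArg (Option.map Sum.inl) h
      · refine lower e.1 b (fun h => hw ?_) _ (lowerLine_of_unmatched e.2) rfl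
        cases b <;> exact congrArg (Option.map Sum.inr) h
      · cases b
        · exact lower p.1.2 false (fun h => hw (congrArg (Option.map Sum.inr) h)) _
            (lowerLine_of_mem p.2) rfl
        · exact upper p.1.1 true (fun h => hw (congrArg (Option.map Sum.inl) h)) _
            (upperLine_of_mem p.2) rfl
  refine ⟨Equiv.ofBijective f hf, ?_, ?_, ?_⟩
  · rintro (x | x) <;> rfl
  · rintro (x | x) (y | y)
    · exact and_congr_left fun _ => upperLine_injective.eq_iff
    · refine ⟨fun h => ?_, fun h => h.elim⟩
      have h3 := upperLine_eq_lowerLine_iff.1 h.1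
      exact Bool.false_ne_true ((show false = sign x from h.2.1.symm).trans (isHead_of_mem h3))
    · refine ⟨fun h => upperLine_eq_lowerLine_iff.1 h.1.symm, fun h => ?_⟩
      have h3 : (line y, line x) ∈ m.pairs := h
      have ht : sign x = false := isTail_of_mem h3
      have hh : sign y = true := isHead_of_mem h3
      exact ⟨(upperLine_eq_lowerLine_iff.2 h).symm, ht, hh⟩
    · exact and_congr_left fun _ => lowerLine_injective.eq_iff
  · rintro (x | x) (y | y) <;>
      change (compose m).endAt (f _).1.1 (f _).1.2 = (compose m).endAt (f _).1.1 (f _).1.2 ↔ _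
    · rw [hend₂, hend₂]
      exact (Option.some_inj.trans Sum.inl_injective.eq_iff).trans vertex_eq_iff
    · rw [hend₂, hend₁]
      exact iff_of_false (fun h => nomatch h) id
    · rw [hend₂, hend₁]
      exact iff_of_false (fun h => nomatch h) id
    · rw [hend₁, hend₁]
      exact (Option.some_inj.trans Sum.inr_injective.eq_iff).trans vertex_eq_iff

end Graph
end HeisenbergWeyl

/-! ### Products and splittings as sums over flags -/

namespace HeisenbergWeyl
open HeisenbergWeyl.Graph HeisenbergWeyl.Flags

noncomputable section

namespace Space

-- The instances are scoped, since the final statement is about existentially bound structures.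

variable (K : Type*) [Field K]

scoped instance instAddCommGroup : AddCommGroup (Space K) :=
  inferInstanceAs (AddCommGroup (Diagram →₀ K))

scoped instance instModule : Module K (Space K) := inferInstanceAs (Module K (Diagram →₀ K))

/-- The basis of the space given by all diagrams. -/
def diagramBasis : Module.Basis Diagram K (Space K) := .ofRepr (LinearEquiv.refl K (Diagram →₀ K))

theorem diagramBasis_diagram (Γ : Graph) : diagramBasis K Γ.diagram = Γ.basis K := rfl

variable {K} {M : Type*} [AddCommGroup M] [Module K M]

theorem hom_ext {f g : Space K →ₗ[K] M} (h : ∀ Γ : Graph, f (Γ.basis K) = g (Γ.basis K)) :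
    f = g :=
  (diagramBasis K).ext (Quotient.ind h)

@[elab_as_elim]
theorem induction_basis {p : Space K → Prop} (x : Space K) (basis : ∀ Γ : Graph, p (Γ.basis K))
    (zero : p 0) (add : ∀ x y, p x → p y → p (x + y)) (smul : ∀ (c : K) x, p x → p (c • x)) :
    p x :=
  Submodule.span_induction (p := fun x _ => p x)
    (by rintro _ ⟨d, rfl⟩; exact Quotient.ind (motive := fun d => p (diagramBasis K d)) basis d)
    zero (fun x y _ _ => add x y) (fun c x _ => smul c x) ((diagramBasis K).mem_span x)

/-- The linear extension of a function of graphs, evaluated at representatives. It is meaningful for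
functions that depend on the diagram only, see `lift_basis`. -/
def lift (F : Graph → M) : Space K →ₗ[K] M := (diagramBasis K).constr K fun d => F (Quotient.out d)

theorem lift_basis {F : Graph → M} (hF : ∀ Γ Γ' : Graph, Iso Γ.flags Γ'.flags → F Γ = F Γ')
    (Γ : Graph) : lift F (Γ.basis K) = F Γ := by
  rw [lift, ← diagramBasis_diagram, Module.Basis.constr_basis]
  exact hF _ _ (diagram_eq_iff.1 (Quotient.out_eq _))

end Space

theorem Graph.basis_congr (K : Type*) [Field K] {Γ Γ' : Graph} (h : Iso Γ.flags Γ'.flags) :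
    Γ.basis K = Γ'.basis K :=
  congrArg (Space.ofDiagram K) (diagram_eq_iff.2 h)

namespace Flags

open scoped HeisenbergWeyl.Space

variable (K : Type*) [Field K] {X Y X' Y' : Flags}

open Classical in
/-- The basis element of a graph with the given flags; zero if there is no such graph. -/
def toSpace (X : Flags) : Space K :=
  if h : ∃ Γ : Graph, Iso Γ.flags X then h.choose.basis K else 0

theorem toSpace_of_iso {Γ : Graph} (hΓ : Iso Γ.flags X) : toSpace K X = Γ.basis K := by
  have h : ∃ Γ' : Graph, Iso Γ'.flags X := ⟨Γ, hΓ⟩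
  rw [toSpace, dif_pos h]
  exact basis_congr K (h.choose_spec.trans hΓ.symm)

theorem toSpace_flags (Γ : Graph) : toSpace K Γ.flags = Γ.basis K :=
  toSpace_of_iso K (Iso.refl _)

theorem toSpace_congr (h : Iso X Y) : toSpace K X = toSpace K Y := by
  by_cases hX : ∃ Γ : Graph, Iso Γ.flags X
  · obtain ⟨Γ, hΓ⟩ := hX
    rw [toSpace_of_iso K hΓ, toSpace_of_iso K (hΓ.trans h)]
  · have hY : ¬ ∃ Γ : Graph, Iso Γ.flags Y := fun ⟨Γ, hΓ⟩ => hX ⟨Γ, hΓ.trans h.symm⟩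
    rw [toSpace, toSpace, dif_neg hX, dif_neg hY]

/-- The sum of all composites, in terms of flags. -/
def prodSum (X Y : Flags) : Space K := ∑ G : Gluing X Y, toSpace K (glue G)

/-- The sum over all splittings into two sets of lines, in terms of flags. -/
def splitSum (X : Flags) : Space K ⊗[K] Space K :=
  ∑ S : X.Closed, toSpace K (X.restrict S.1) ⊗ₜ toSpace K (X.restrict S.compl.1)

theorem prodSum_congr (h : Iso X X') (h' : Iso Y Y') : prodSum K X Y = prodSum K X' Y' := by
  obtain ⟨e, he⟩ := h
  obtain ⟨f, hf⟩ := h'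
  exact Fintype.sum_equiv (Gluing.mapEquiv he hf) _ _
    fun G => toSpace_congr K (G.glue_map he hf)

theorem splitSum_congr (h : Iso X Y) : splitSum K X = splitSum K Y := by
  obtain ⟨e, he⟩ := h
  let c : X.Closed ≃ Y.Closed := (Equiv.Set.congr e).subtypeEquiv fun S => by
    refine ⟨fun hS a b hab => ?_, fun hS a b hab => ?_⟩
    · simpa [Equiv.Set.congr, ← Equiv.eq_symm_apply] using
        hS (e.symm a) (e.symm b) ((he.symm.joined a b).2 hab)
    · simpa [Equiv.Set.congr] using hS (e a) (e b) ((he.joined a b).2 hab)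
  have hc : ∀ (S : X.Closed) a, a ∈ S.1 ↔ e a ∈ (c S).1 :=
    fun S a => e.injective.mem_set_image.symm
  refine Fintype.sum_equiv c _ _ fun S => ?_
  rw [toSpace_congr K (he.restrict (hc S)),
    toSpace_congr K (he.restrict (S := S.compl.1) (T := (c S).compl.1) fun a => not_congr (hc S a))]

theorem prodSum_assoc (X Y Z : Flags) :
    ∑ G : Gluing X Y, prodSum K (glue G) Z = ∑ H : Gluing Y Z, prodSum K X (glue H) := by
  simp only [prodSum, ← Fintype.sum_sigma' (fun (G : Gluing X Y) (H : Gluing (glue G) Z) =>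
    toSpace K (glue H)), ← Fintype.sum_sigma' (fun (G : Gluing Y Z) (H : Gluing X (glue G)) =>
    toSpace K (glue H))]
  exact Fintype.sum_equiv (Gluing.assocEquiv X Y Z) _ _ fun p =>
    toSpace_congr K (Gluing.glue_assoc p)

theorem prodSum_of_isEmpty_left [IsEmpty X.W] : prodSum K X Y = toSpace K Y := by
  let G₀ : Gluing X Y := ⟨fun _ _ => False, by simp, by simp, by simp, by simp, by simp, by simp⟩
  have huniq : ∀ G : Gluing X Y, G = G₀ := fun G => Gluing.ext (funext fun x => isEmptyElim x)
  rw [prodSum, Fintype.sum_eq_single G₀ fun G hG => (hG (huniq G)).elim]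
  refine toSpace_congr K ⟨Equiv.emptySum _ _, ?_, ?_, ?_⟩
  · rintro (x | y)
    exacts [isEmptyElim x, Iff.rfl]
  · rintro (x | y) (x' | y')
    exacts [isEmptyElim x, isEmptyElim x, isEmptyElim x', Iff.rfl]
  · rintro (x | y) (x' | y')
    exacts [isEmptyElim x, isEmptyElim x, isEmptyElim x', Iff.rfl]

theorem prodSum_of_isEmpty_right [IsEmpty Y.W] : prodSum K X Y = toSpace K X := by
  let G₀ : Gluing X Y := ⟨fun _ _ => False, by simp, by simp, by simp, by simp, by simp, by simp⟩
  have huniq : ∀ G : Gluing X Y, G = G₀ :=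
    fun G => Gluing.ext (funext fun x => funext fun y => isEmptyElim y)
  rw [prodSum, Fintype.sum_eq_single G₀ fun G hG => (hG (huniq G)).elim]
  refine toSpace_congr K ⟨Equiv.sumEmpty _ _, ?_, ?_, ?_⟩
  · rintro (x | y)
    exacts [Iff.rfl, isEmptyElim y]
  · rintro (x | y) (x' | y')
    exacts [Iff.rfl, isEmptyElim y', isEmptyElim y, isEmptyElim y]
  · rintro (x | y) (x' | y')
    exacts [Iff.rfl, isEmptyElim y', isEmptyElim y, isEmptyElim y]

/-- Splitting the composites amounts to composing the parts of two splittings: a line of a composite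
that is created by the matching belongs to the part to which both its pieces belong. -/
theorem sum_splitSum_glue (X Y : Flags) :
    ∑ G : Gluing X Y, splitSum K (glue G) = ∑ A : X.Closed, ∑ B : Y.Closed,
      prodSum K (X.restrict A.1) (Y.restrict B.1) ⊗ₜ[K]
        prodSum K (X.restrict A.compl.1) (Y.restrict B.compl.1) := by
  classical
  simp only [splitSum]
  rw [← Fintype.sum_sigma' (fun (G : Gluing X Y) (C : (glue G).Closed) =>
    toSpace K ((glue G).restrict C.1) ⊗ₜ[K] toSpace K ((glue G).restrict C.compl.1)),
    ← Fintype.sum_prod_type']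
  have h : ∀ p : X.Closed × Y.Closed,
      prodSum K (X.restrict p.1.1) (Y.restrict p.2.1) ⊗ₜ[K]
        prodSum K (X.restrict p.1.compl.1) (Y.restrict p.2.compl.1) =
      ∑ G : {G : Gluing X Y // G.Respects p.1.1 p.2.1},
        toSpace K (glue (G.1.restrict p.1.1 p.2.1)) ⊗ₜ[K]
          toSpace K (glue (G.1.restrict p.1.compl.1 p.2.compl.1)) := by
    intro p
    rw [prodSum, prodSum, TensorProduct.sum_tmul]
    simp only [TensorProduct.tmul_sum]
    rw [← Fintype.sum_prod_type']
    exact (Fintype.sum_equiv (Gluing.splitEquiv p.1 p.2) _ _ fun G => rfl).symm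
  rw [Fintype.sum_congr _ _ h, ← Fintype.sum_sigma']
  refine Fintype.sum_equiv (closedGlueEquiv X Y) _ _ fun q => ?_
  exact congrArg₂ _ (toSpace_congr K (q.1.glue_restrict _)) (toSpace_congr K (q.1.glue_restrict _))

/-- Sums over matchings are sums over gluings of flags. -/
theorem sum_compose {M : Type*} [AddCommMonoid M] {Γ₂ Γ₁ : Graph} (F : Flags → M)
    (hF : ∀ X Y, Iso X Y → F X = F Y) :
    ∑ m : Matching Γ₂ Γ₁, F (compose m).flags = ∑ G : Gluing Γ₂.flags Γ₁.flags, F (glue G) :=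
  Fintype.sum_equiv (Equiv.ofBijective _ gluing_bijective) _ _
    fun m => hF _ _ (flags_compose m).symm

theorem prodSum_flags (Γ₂ Γ₁ : Graph) :
    prodSum K Γ₂.flags Γ₁.flags = ∑ m : Matching Γ₂ Γ₁, (compose m).basis K := by
  rw [prodSum, ← sum_compose (toSpace K) fun _ _ => toSpace_congr K]
  simp only [toSpace_flags]

/-- Sums over sets of lines are sums over closed sets of flags. -/
theorem sum_restrict {M : Type*} [AddCommMonoid M] {Γ : Graph} (F : Flags → Flags → M)
    (hF : ∀ X Y X' Y', Iso X Y → Iso X' Y' → F X X' = F Y Y') :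
    ∑ L : Set Γ.E, F (Γ.restrict L).flags (Γ.restrict Lᶜ).flags =
      ∑ S : Γ.flags.Closed, F (Γ.flags.restrict S.1) (Γ.flags.restrict S.compl.1) :=
  Fintype.sum_equiv Γ.closedEquiv _ _ fun L => hF _ _ _ _ (flags_restrict L) (flags_restrict Lᶜ)

theorem splitSum_flags (Γ : Graph) :
    splitSum K Γ.flags = ∑ L : Set Γ.E, (Γ.restrict L).basis K ⊗ₜ[K] (Γ.restrict Lᶜ).basis K := by
  rw [splitSum, ← sum_restrict (fun X Y => toSpace K X ⊗ₜ[K] toSpace K Y)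
    fun _ _ _ _ h h' => by rw [toSpace_congr K h, toSpace_congr K h']]
  simp only [toSpace_flags]

end Flags

end

end HeisenbergWeyl

/-! ### The bialgebra of diagrams -/

namespace HeisenbergWeyl
open HeisenbergWeyl.Graph HeisenbergWeyl.Flags

noncomputable section

namespace Graph

theorem isEmpty_empty : IsEmpty empty.E := inferInstanceAs (IsEmpty Empty)

instance : IsEmpty empty.flags.W := isEmpty_flags_iff.2 isEmpty_empty

variable {Γ : Graph}

theorem basis_of_isEmpty (K : Type*) [Field K] (h : IsEmpty Γ.E) : Γ.basis K = empty.basis K :=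
  congrArg (Space.ofDiagram K) (diagram_eq_void_iff.2 h)

end Graph

namespace Space

variable (K : Type*) [Field K]

/-- The product as a bilinear map. -/
def mulMap : Space K →ₗ[K] Space K →ₗ[K] Space K :=
  lift fun Γ₂ => lift fun Γ₁ => prodSum K Γ₂.flags Γ₁.flags

variable {K}

theorem mulMap_basis (Γ₂ Γ₁ : Graph) :
    mulMap K (Γ₂.basis K) (Γ₁.basis K) = prodSum K Γ₂.flags Γ₁.flags := by
  rw [mulMap, lift_basis, lift_basis fun Γ Γ' h => prodSum_congr K (Iso.refl _) h]
  intro Γ Γ' h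
  simp only [prodSum_congr K h (Iso.refl _)]

theorem mulMap_assoc (x y z : Space K) :
    mulMap K (mulMap K x y) z = mulMap K x (mulMap K y z) := by
  induction x using induction_basis with
  | zero => simp
  | add x x' hx hx' => simp [hx, hx']
  | smul c x hx => simp [hx]
  | basis Γ₃ =>
  induction y using induction_basis with
  | zero => simp
  | add x x' hx hx' => simp [hx, hx']
  | smul c x hx => simp [hx]
  | basis Γ₂ =>
  induction z using induction_basis with
  | zero => simp
  | add x x' hx hx' => simp [hx, hx']
  | smul c x hx => simp [hx]
  | basis Γ₁ =>
  rw [mulMap_basis, mulMap_basis, prodSum_flags, prodSum_flags, map_sum, map_sum,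
    LinearMap.sum_apply]
  simp only [mulMap_basis]
  rw [sum_compose (fun X => prodSum K X Γ₁.flags) fun _ _ h => prodSum_congr K h (Iso.refl _),
    sum_compose (fun X => prodSum K Γ₃.flags X) fun _ _ h => prodSum_congr K (Iso.refl _) h]
  exact prodSum_assoc K _ _ _

theorem empty_mulMap (x : Space K) : mulMap K (empty.basis K) x = x := by
  induction x using induction_basis with
  | zero => simp
  | add x x' hx hx' => simp [hx, hx']
  | smul c x hx => simp [hx]
  | basis Γ => rw [mulMap_basis, prodSum_of_isEmpty_left, toSpace_flags]

theorem mulMap_empty (x : Space K) : mulMap K x (empty.basis K) = x := by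
  induction x using induction_basis with
  | zero => simp
  | add x x' hx hx' => simp [hx, hx']
  | smul c x hx => simp [hx]
  | basis Γ => rw [mulMap_basis, prodSum_of_isEmpty_right, toSpace_flags]

scoped instance instRing : Ring (Space K) where
  __ := (inferInstance : AddCommGroup (Space K))
  mul x y := mulMap K x y
  one := empty.basis K
  left_distrib x y z := map_add (mulMap K x) y z
  right_distrib x y z := by
    change mulMap K (x + y) z = mulMap K x z + mulMap K y z
    simp
  zero_mul x := by
    change mulMap K 0 x = 0
    simp
  mul_zero x := map_zero (mulMap K x)
  mul_assoc := mulMap_assoc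
  one_mul := empty_mulMap
  mul_one := mulMap_empty

scoped instance instAlgebra : Algebra K (Space K) :=
  Algebra.ofModule
    (fun r x y => by
      change mulMap K (r • x) y = r • mulMap K x y
      simp)
    (fun r x y => map_smul (mulMap K x) r y)

theorem one_eq : (1 : Space K) = empty.basis K := rfl

theorem basis_mul_basis (Γ₂ Γ₁ : Graph) :
    Γ₂.basis K * Γ₁.basis K = prodSum K Γ₂.flags Γ₁.flags :=
  mulMap_basis Γ₂ Γ₁

variable (K) in
/-- The coproduct as a linear map. -/
def comulMap : Space K →ₗ[K] Space K ⊗[K] Space K := lift fun Γ => splitSum K Γ.flags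

theorem comulMap_eq_splitSum (Γ : Graph) : comulMap K (Γ.basis K) = splitSum K Γ.flags :=
  lift_basis (fun _ _ h => splitSum_congr K h) Γ

theorem comulMap_basis (Γ : Graph) : comulMap K (Γ.basis K) =
    ∑ L : Set Γ.E, (Γ.restrict L).basis K ⊗ₜ[K] (Γ.restrict Lᶜ).basis K :=
  (comulMap_eq_splitSum Γ).trans (splitSum_flags K Γ)

open Classical in
variable (K) in
/-- The counit as a linear map. -/
def counitMap : Space K →ₗ[K] K := lift fun Γ => if IsEmpty Γ.E then 1 else 0

open Classical in
theorem counitMap_basis (Γ : Graph) :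
    counitMap K (Γ.basis K) = if IsEmpty Γ.E then 1 else 0 := by
  refine lift_basis (fun Γ Γ' ⟨e, _⟩ => ?_) Γ
  simp only [← isEmpty_flags_iff, e.isEmpty_congr]

end Space

/-- Summing over the subsets of `A` as subsets of the ambient type. -/
theorem sum_image_val {E M : Type*} [AddCommMonoid M] (A : Set E) {_ : Fintype (Set A)}
    [Fintype (Set E)] [DecidablePred fun B : Set E => B ⊆ A] (f : Set E → M) :
    ∑ B : Set A, f (Subtype.val '' B) = ∑ B : Set E with B ⊆ A, f B := by
  refine Finset.sum_bij (fun B _ => Subtype.val '' B) (fun B _ => ?_) (fun B _ B' _ h => ?_)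
    (fun B hB => ?_) (fun _ _ => rfl)
  · simp
  · exact Subtype.val_injective.image_injective h
  · exact ⟨Subtype.val ⁻¹' B, Finset.mem_univ _, by simpa using hB⟩

open Classical in
/-- A chain of two subsets, or a subset of the complement of another, both encode an ordered
partition into three parts. -/
theorem sum_subset_sdiff {E M : Type*} [AddCommMonoid M] [Fintype (Set E)]
    (f : Set E → Set E → Set E → M) :
    ∑ A : Set E, ∑ B : Set E with B ⊆ A, f B (A \ B) Aᶜ =
      ∑ A : Set E, ∑ B : Set E with B ⊆ Aᶜ, f A B (Aᶜ \ B) := by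
  rw [Finset.sum_sigma', Finset.sum_sigma']
  refine Finset.sum_bij' (fun p _ => ⟨p.2, p.1 \ p.2⟩) (fun p _ => ⟨p.1 ∪ p.2, p.1⟩)
    ?_ ?_ ?_ ?_ ?_
  · rintro ⟨A, B⟩ h
    simp only [Finset.mem_sigma, Finset.mem_univ, Finset.mem_filter, true_and] at h ⊢
    exact fun x hx => hx.2
  · rintro ⟨A, B⟩ h
    simp
  · rintro ⟨A, B⟩ h
    simp only [Finset.mem_sigma, Finset.mem_univ, Finset.mem_filter, true_and] at h
    simp [Set.union_eq_self_of_subset_left h]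
  · rintro ⟨A, B⟩ h
    simp only [Finset.mem_sigma, Finset.mem_univ, Finset.mem_filter, true_and] at h
    have : (A ∪ B) \ A = B := by
      rw [Set.union_sdiff_left]
      exact (Set.disjoint_left.2 fun x hx => h hx).sdiff_eq_left
    simp [this]
  · rintro ⟨A, B⟩ h
    simp only [Finset.mem_sigma, Finset.mem_univ, Finset.mem_filter, true_and] at h
    have : Bᶜ \ (A \ B) = Aᶜ := by
      ext x
      have := @h x
      simp only [Set.mem_sdiff, Set.mem_compl_iff]
      tauto
    rw [this]

namespace Space
variable {K : Type*} [Field K]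

open Classical in
theorem comulMap_restrict (Γ : Graph) (A : Set Γ.E) : comulMap K ((Γ.restrict A).basis K) =
    ∑ B : Set Γ.E with B ⊆ A, (Γ.restrict B).basis K ⊗ₜ[K] (Γ.restrict (A \ B)).basis K := by
  rw [comulMap_basis]
  refine (Finset.sum_congr rfl fun B _ => ?_).trans (sum_image_val A fun B : Set Γ.E =>
    (Γ.restrict B).basis K ⊗ₜ[K] (Γ.restrict (A \ B)).basis K)
  rw [basis_congr K (flags_restrict_restrict A B), basis_congr K (flags_restrict_restrict A Bᶜ)]
  congr 4
  exact Set.image_val_compl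

theorem comulMap_coassoc (Γ : Graph) :
    TensorProduct.assoc K (Space K) (Space K) (Space K)
        ((comulMap K).rTensor (Space K) (comulMap K (Γ.basis K))) =
      (comulMap K).lTensor (Space K) (comulMap K (Γ.basis K)) := by
  classical
  rw [comulMap_basis Γ]
  simp only [map_sum, LinearMap.rTensor_tmul, LinearMap.lTensor_tmul, comulMap_restrict,
    TensorProduct.sum_tmul, TensorProduct.tmul_sum, TensorProduct.assoc_tmul]
  exact sum_subset_sdiff fun A B C =>
    (Γ.restrict A).basis K ⊗ₜ[K] ((Γ.restrict B).basis K ⊗ₜ[K] (Γ.restrict C).basis K)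

open Classical in
theorem counitMap_restrict (Γ : Graph) (A : Set Γ.E) :
    counitMap K ((Γ.restrict A).basis K) = if A = ∅ then 1 else 0 := by
  rw [counitMap_basis]
  exact if_congr Set.isEmpty_coe_sort rfl rfl

scoped instance instCoalgebra : Coalgebra K (Space K) where
  comul := comulMap K
  counit := counitMap K
  coassoc := hom_ext comulMap_coassoc
  rTensor_counit_comp_comul := hom_ext fun Γ => by
    classical
    simp only [LinearMap.comp_apply, comulMap_basis, map_sum, LinearMap.rTensor_tmul,
      counitMap_restrict]
    rw [Fintype.sum_eq_single ∅ fun L hL => by simp [hL]]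
    simp [basis_congr K Γ.flags_restrict_univ]
  lTensor_counit_comp_comul := hom_ext fun Γ => by
    classical
    simp only [LinearMap.comp_apply, comulMap_basis, map_sum, LinearMap.lTensor_tmul,
      counitMap_restrict]
    rw [Fintype.sum_eq_single Set.univ fun L hL => by simp [hL]]
    simp [basis_congr K Γ.flags_restrict_univ]

theorem comul_basis (Γ : Graph) : Coalgebra.comul (R := K) (Γ.basis K) =
    ∑ L : Set Γ.E, (Γ.restrict L).basis K ⊗ₜ[K] (Γ.restrict Lᶜ).basis K :=
  comulMap_basis Γ

open Classical in
theorem counit_basis (Γ : Graph) :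
    Coalgebra.counit (R := K) (Γ.basis K) = if IsEmpty Γ.E then (1 : K) else 0 :=
  counitMap_basis Γ

scoped instance instIsCocomm : Coalgebra.IsCocomm K (Space K) where
  comm_comp_comul := hom_ext fun Γ => by
    simp only [LinearMap.comp_apply, comul_basis, map_sum]
    refine Fintype.sum_equiv (compl_involutive.toPerm _) _ _ fun L => ?_
    simp

theorem comul_basis_mul_basis (Γ₂ Γ₁ : Graph) :
    Coalgebra.comul (R := K) (Γ₂.basis K * Γ₁.basis K) =
      Coalgebra.comul (R := K) (Γ₂.basis K) * Coalgebra.comul (R := K) (Γ₁.basis K) := by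
  calc Coalgebra.comul (R := K) (Γ₂.basis K * Γ₁.basis K)
      = ∑ m : Matching Γ₂ Γ₁, splitSum K (compose m).flags := by
        rw [basis_mul_basis, prodSum_flags, map_sum]
        exact Finset.sum_congr rfl fun m _ => comulMap_eq_splitSum _
    _ = ∑ A : Γ₂.flags.Closed, ∑ B : Γ₁.flags.Closed,
          prodSum K (Γ₂.flags.restrict A.1) (Γ₁.flags.restrict B.1) ⊗ₜ[K]
            prodSum K (Γ₂.flags.restrict A.compl.1) (Γ₁.flags.restrict B.compl.1) := by
        rw [sum_compose (splitSum K) fun _ _ => splitSum_congr K, sum_splitSum_glue]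
    _ = ∑ L : Set Γ₂.E, ∑ B : Γ₁.flags.Closed,
          prodSum K (Γ₂.restrict L).flags (Γ₁.flags.restrict B.1) ⊗ₜ[K]
            prodSum K (Γ₂.restrict Lᶜ).flags (Γ₁.flags.restrict B.compl.1) :=
        (sum_restrict (fun X X' => ∑ B : Γ₁.flags.Closed,
          prodSum K X (Γ₁.flags.restrict B.1) ⊗ₜ[K] prodSum K X' (Γ₁.flags.restrict B.compl.1))
          fun _ _ _ _ h h' => by
            simp only [prodSum_congr K h (Iso.refl _), prodSum_congr K h' (Iso.refl _)]).symm
    _ = ∑ L : Set Γ₂.E, ∑ L' : Set Γ₁.E,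
          prodSum K (Γ₂.restrict L).flags (Γ₁.restrict L').flags ⊗ₜ[K]
            prodSum K (Γ₂.restrict Lᶜ).flags (Γ₁.restrict L'ᶜ).flags :=
        Finset.sum_congr rfl fun L _ => (sum_restrict (fun Y Y' =>
          prodSum K (Γ₂.restrict L).flags Y ⊗ₜ[K] prodSum K (Γ₂.restrict Lᶜ).flags Y')
          fun _ _ _ _ h h' => by
            rw [prodSum_congr K (Iso.refl _) h, prodSum_congr K (Iso.refl _) h']).symm
    _ = _ := by
        rw [comul_basis, comul_basis, Finset.sum_mul_sum]
        simp only [Algebra.TensorProduct.tmul_mul_tmul, basis_mul_basis]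

theorem counit_basis_mul_basis (Γ₂ Γ₁ : Graph) :
    Coalgebra.counit (R := K) (Γ₂.basis K * Γ₁.basis K) =
      Coalgebra.counit (R := K) (Γ₂.basis K) * Coalgebra.counit (R := K) (Γ₁.basis K) := by
  classical
  by_cases h₂ : IsEmpty Γ₂.E
  · rw [basis_of_isEmpty K h₂, ← one_eq, one_mul, one_eq, counit_basis empty,
      if_pos isEmpty_empty, one_mul]
  · -- A composite with a nonempty graph has a line.
    rw [basis_mul_basis, prodSum_flags, map_sum, counit_basis Γ₂, if_neg h₂, zero_mul]
    refine Finset.sum_eq_zero fun m _ => ?_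
    rw [counit_basis, if_neg]
    intro h
    exact h₂ ⟨fun e => h.elim (upperLine m e)⟩

scoped instance instBialgebra : Bialgebra K (Space K) :=
  Bialgebra.mk' K (Space K)
    (by
      classical
      exact (counit_basis empty).trans (if_pos isEmpty_empty))
    (by
      intro x y
      induction x using induction_basis with
      | zero => simp
      | add x x' hx hx' => simp [add_mul, hx, hx']
      | smul c x hx => simp [hx, mul_assoc]
      | basis Γ₂ =>
      induction y using induction_basis with
      | zero => simp
      | add x x' hx hx' => simp [mul_add, hx, hx']
      | smul c x hx => simp [hx, mul_left_comm]
      | basis Γ₁ => exact counit_basis_mul_basis Γ₂ Γ₁)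
    (by
      have := isEmpty_empty
      rw [one_eq, comul_basis, Algebra.TensorProduct.one_def, one_eq,
        Fintype.sum_eq_single ∅ fun L hL => (hL (Set.eq_empty_of_isEmpty L)).elim]
      rw [basis_of_isEmpty K (Γ := empty.restrict ∅) ⟨fun e => isEmpty_empty.elim e.1⟩,
        basis_of_isEmpty K (Γ := empty.restrict ∅ᶜ) ⟨fun e => isEmpty_empty.elim e.1⟩])
    (by
      intro x y
      induction x using induction_basis with
      | zero => simp
      | add x x' hx hx' => simp [add_mul, hx, hx']
      | smul c x hx => simp [hx]
      | basis Γ₂ =>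
      induction y using induction_basis with
      | zero => simp
      | add x x' hx hx' => simp [mul_add, hx, hx']
      | smul c x hx => simp [hx]
      | basis Γ₁ => exact comul_basis_mul_basis Γ₂ Γ₁)

end Space
end
end HeisenbergWeyl

/-! ### The antipode -/

namespace HeisenbergWeyl
open HeisenbergWeyl.Graph HeisenbergWeyl.Flags

/-- An ordered partition into `n + 1` blocks consists of its first block and an ordered partition of
the complement. -/
def OrderedPartition.consEquiv (E : Type) (n : ℕ) :
    OrderedPartition E (n + 1) ≃ Σ A : {A : Set E // A.Nonempty}, OrderedPartition ↥(A.1ᶜ) n where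
  toFun P := ⟨⟨P.block 0, P.nonempty 0⟩,
    { block := fun i => Subtype.val ⁻¹' P.block i.succ
      nonempty := fun i => by
        obtain ⟨x, hx⟩ := P.nonempty i.succ
        exact ⟨⟨x, Set.disjoint_left.1 (P.disjoint i.succ 0 i.succ_ne_zero) hx⟩, hx⟩
      disjoint := fun i j hij =>
        (P.disjoint _ _ fun h => hij (Fin.succ_injective _ h)).preimage _
      cover := Set.eq_univ_of_forall fun x => by
        obtain ⟨i, hi⟩ := Set.mem_iUnion.1 (P.cover ▸ Set.mem_univ x.1)
        obtain rfl | ⟨j, rfl⟩ := i.eq_zero_or_eq_succ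
        · exact (x.2 hi).elim
        · exact Set.mem_iUnion.2 ⟨j, hi⟩ }⟩
  invFun p :=
    { block := Fin.cons p.1.1 fun i => Subtype.val '' p.2.block i
      nonempty := fun i => by
        obtain rfl | ⟨j, rfl⟩ := i.eq_zero_or_eq_succ
        · exact p.1.2
        · exact (p.2.nonempty j).image _
      disjoint := fun i j hij => by
        have h : ∀ k, Disjoint p.1.1 (Subtype.val '' p.2.block k) := fun k =>
          Set.disjoint_left.2 fun x hx ⟨y, _, hy⟩ => y.2 (hy ▸ hx)
        obtain rfl | ⟨k, rfl⟩ := i.eq_zero_or_eq_succ <;>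
          obtain rfl | ⟨l, rfl⟩ := j.eq_zero_or_eq_succ
        · exact (hij rfl).elim
        · exact h l
        · exact (h k).symm
        · exact Set.disjoint_image_of_injective Subtype.val_injective
            (p.2.disjoint k l fun h => hij (congrArg _ h))
      cover := Set.eq_univ_of_forall fun x => by
        by_cases hx : x ∈ p.1.1
        · exact Set.mem_iUnion.2 ⟨0, hx⟩
        · obtain ⟨i, hi⟩ := Set.mem_iUnion.1
            (p.2.cover ▸ Set.mem_univ (⟨x, hx⟩ : ↥(p.1.1ᶜ)))
          exact Set.mem_iUnion.2 ⟨i.succ, ⟨x, hx⟩, hi, rfl⟩ }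
  left_inv P := by
    ext i : 2
    obtain rfl | ⟨j, rfl⟩ := i.eq_zero_or_eq_succ
    · rfl
    · refine (Subtype.image_preimage_val _ _).trans (Set.inter_eq_right.2 fun x hx => ?_)
      exact Set.disjoint_left.1 (P.disjoint j.succ 0 j.succ_ne_zero) hx
  right_inv p := by
    refine Sigma.ext rfl (heq_of_eq (OrderedPartition.ext (funext fun i => ?_)))
    exact Set.preimage_image_eq _ Subtype.val_injective

noncomputable section

namespace Space

open WithConv

variable (K : Type*) [Field K]

/-- The identity minus the projection `x ↦ ε(x) 1`, in the convolution algebra. -/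
def reduced : WithConv (Space K →ₗ[K] Space K) := toConv LinearMap.id - 1

variable {K}

theorem conv_mul_basis (f g : WithConv (Space K →ₗ[K] Space K)) (Γ : Graph) :
    (f * g) (Γ.basis K) =
      ∑ L : Set Γ.E, f ((Γ.restrict L).basis K) * g ((Γ.restrict Lᶜ).basis K) := by
  rw [LinearMap.convMul_apply, comul_basis, map_sum, map_sum]
  rfl

open Classical in
theorem reduced_basis (Γ : Graph) :
    reduced K (Γ.basis K) = if IsEmpty Γ.E then 0 else Γ.basis K := by
  change Γ.basis K - algebraMap K (Space K) (Coalgebra.counit (Γ.basis K)) = _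
  rw [counit_basis]
  split_ifs with h
  · rw [map_one, basis_of_isEmpty K h, one_eq, sub_self]
  · simp

theorem conv_one_basis (Γ : Graph) : (1 : WithConv (Space K →ₗ[K] Space K)) (Γ.basis K) =
    ∑ P : OrderedPartition Γ.E 0,
      (List.ofFn fun i : Fin 0 => (Γ.restrict (P.block i)).basis K).prod := by
  classical
  rw [LinearMap.convOne_apply, counit_basis]
  split_ifs with h
  · let P₀ : OrderedPartition Γ.E 0 := ⟨Fin.elim0, fun i => i.elim0, fun i => i.elim0,
      Set.eq_univ_of_forall fun x => h.elim x⟩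
    rw [Fintype.sum_eq_single P₀ fun P hP =>
      (hP (OrderedPartition.ext (funext fun i => i.elim0))).elim]
    simp
  · rw [map_zero, eq_comm]
    refine Finset.sum_eq_zero fun P _ => (h ⟨fun x => ?_⟩).elim
    obtain ⟨i, _⟩ := Set.mem_iUnion.1 (P.cover ▸ Set.mem_univ x)
    exact i.elim0

/-- The convolution powers of the reduced identity enumerate the ordered partitions of the lines. -/
theorem reduced_pow_basis (n : ℕ) (Γ : Graph) : (reduced K ^ n) (Γ.basis K) =
    ∑ P : OrderedPartition Γ.E n,
      (List.ofFn fun i : Fin n => (Γ.restrict (P.block i)).basis K).prod := by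
  classical
  induction n generalizing Γ with
  | zero => rw [pow_zero, conv_one_basis]
  | succ n ih =>
    have hterm : ∀ L : Set Γ.E,
        reduced K ((Γ.restrict L).basis K) * (reduced K ^ n) ((Γ.restrict Lᶜ).basis K) =
          if L.Nonempty then ∑ P : OrderedPartition ↥(Lᶜ) n, (Γ.restrict L).basis K *
            (List.ofFn fun i : Fin n => (Γ.restrict (Subtype.val '' P.block i)).basis K).prod
          else 0 := by
      intro L
      have hiff : IsEmpty (Γ.restrict L).E ↔ ¬ L.Nonempty :=
        Set.isEmpty_coe_sort.trans Set.not_nonempty_iff_eq_empty.symm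
      rw [reduced_basis, ih, if_congr hiff rfl rfl, ite_not, ite_mul, zero_mul, Finset.mul_sum]
      refine if_congr Iff.rfl (Finset.sum_congr rfl fun P _ => ?_) rfl
      simp only [basis_congr K (flags_restrict_restrict _ _)]
    rw [pow_succ', conv_mul_basis, Finset.sum_congr rfl fun L _ => hterm L, ← Finset.sum_filter,
      Finset.sum_subtype (p := Set.Nonempty) _ (fun L => by simp), ← Fintype.sum_sigma'
        (fun (A : {A : Set Γ.E // A.Nonempty}) (P : OrderedPartition ↥(A.1ᶜ) n) =>
          (Γ.restrict A.1).basis K *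
            (List.ofFn fun i : Fin n => (Γ.restrict (Subtype.val '' P.block i)).basis K).prod)]
    refine Fintype.sum_equiv (OrderedPartition.consEquiv Γ.E n).symm _ _ fun p => ?_
    rw [List.ofFn_succ, List.prod_cons]
    rfl

theorem reduced_pow_basis_eq_zero {n : ℕ} {Γ : Graph} (h : Fintype.card Γ.E < n) :
    (reduced K ^ n) (Γ.basis K) = 0 := by
  rw [reduced_pow_basis]
  exact Finset.sum_eq_zero fun P _ => absurd P.le_card h.not_ge

variable (K) in
/-- The truncated geometric series `∑ (-1)^n J^n` for the reduced identity `J`. -/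
def partialAntipode (N : ℕ) : WithConv (Space K →ₗ[K] Space K) :=
  ∑ n ∈ Finset.range N, (-reduced K) ^ n

theorem conv_sum_apply {ι : Type*} (s : Finset ι) (f : ι → WithConv (Space K →ₗ[K] Space K))
    (x : Space K) : (∑ i ∈ s, f i) x = ∑ i ∈ s, f i x := by
  classical
  induction s using Finset.induction_on with
  | empty => rfl
  | insert i s hi ih => rw [Finset.sum_insert hi, Finset.sum_insert hi, ← ih]; rfl

theorem neg_reduced_pow_apply (n : ℕ) (x : Space K) :
    ((-reduced K) ^ n) x = (-1 : K) ^ n • (reduced K ^ n) x := by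
  rcases n.even_or_odd with h | h
  · rw [h.neg_pow (reduced K), h.neg_one_pow, one_smul]
  · rw [h.neg_pow (reduced K), h.neg_one_pow, neg_one_smul]
    rfl

theorem partialAntipode_basis (N : ℕ) (Γ : Graph) : partialAntipode K N (Γ.basis K) =
    ∑ n ∈ Finset.range N, (-1 : K) ^ n • (reduced K ^ n) (Γ.basis K) := by
  rw [partialAntipode, conv_sum_apply]
  exact Finset.sum_congr rfl fun n _ => neg_reduced_pow_apply n _

/-- The truncated series is constant beyond the number of lines. -/
theorem partialAntipode_basis_eq {N : ℕ} {Γ : Graph} (h : Fintype.card Γ.E < N) :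
    partialAntipode K N (Γ.basis K) = partialAntipode K (Fintype.card Γ.E + 1) (Γ.basis K) := by
  rw [partialAntipode_basis, partialAntipode_basis]
  refine (Finset.sum_subset (Finset.range_subset_range.2 h) fun n _ hn => ?_).symm
  rw [reduced_pow_basis_eq_zero (by simpa using hn), smul_zero]

variable (K) in
/-- The antipode: on a graph, the geometric series stops after its number of lines. -/
def antipodeMap : Space K →ₗ[K] Space K :=
  lift fun Γ => partialAntipode K (Fintype.card Γ.E + 1) (Γ.basis K)

theorem antipodeMap_basis (Γ : Graph) :
    antipodeMap K (Γ.basis K) = partialAntipode K (Fintype.card Γ.E + 1) (Γ.basis K) := by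
  refine lift_basis (fun Γ Γ' h => ?_) Γ
  obtain ⟨e, _⟩ := equivalent_iff_iso.2 h
  rw [basis_congr K h, Fintype.card_congr e]

theorem antipodeMap_restrict (Γ : Graph) (A : Set Γ.E) :
    antipodeMap K ((Γ.restrict A).basis K) =
      partialAntipode K (Fintype.card Γ.E + 1) ((Γ.restrict A).basis K) := by
  have h : Fintype.card (Γ.restrict A).E ≤ Fintype.card Γ.E :=
    Fintype.card_le_of_injective (Subtype.val : A → Γ.E) Subtype.val_injective
  rw [antipodeMap_basis, partialAntipode_basis_eq (Nat.lt_succ_of_le h)]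

theorem toConv_id : toConv LinearMap.id = 1 - (-reduced K) := by
  rw [reduced, sub_neg_eq_add, add_sub_cancel]

theorem one_sub_neg_reduced_pow_basis (Γ : Graph) :
    (1 - (-reduced K) ^ (Fintype.card Γ.E + 1)) (Γ.basis K) =
      algebraMap K (Space K) (Coalgebra.counit (Γ.basis K)) := by
  change algebraMap K (Space K) (Coalgebra.counit (Γ.basis K)) -
    ((-reduced K) ^ (Fintype.card Γ.E + 1)) (Γ.basis K) = _
  rw [neg_reduced_pow_apply, reduced_pow_basis_eq_zero (Nat.lt_succ_self _), smul_zero, sub_zero]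

scoped instance instHopfAlgebra : HopfAlgebra K (Space K) where
  antipode := antipodeMap K
  mul_antipode_rTensor_comul := hom_ext fun Γ => by
    simp only [LinearMap.comp_apply, comul_basis, map_sum, LinearMap.rTensor_tmul,
      LinearMap.mul'_apply, antipodeMap_restrict]
    have h := conv_mul_basis (partialAntipode K (Fintype.card Γ.E + 1)) (toConv LinearMap.id) Γ
    rw [toConv_id, partialAntipode, geom_sum_mul_neg, one_sub_neg_reduced_pow_basis,
      ← toConv_id] at h
    exact h.symm
  mul_antipode_lTensor_comul := hom_ext fun Γ => by
    simp only [LinearMap.comp_apply, comul_basis, map_sum, LinearMap.lTensor_tmul,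
      LinearMap.mul'_apply, antipodeMap_restrict]
    have h := conv_mul_basis (toConv LinearMap.id) (partialAntipode K (Fintype.card Γ.E + 1)) Γ
    rw [toConv_id, partialAntipode, mul_neg_geom_sum, one_sub_neg_reduced_pow_basis,
      ← toConv_id] at h
    exact h.symm

theorem antipode_basis (Γ : Graph) : HopfAlgebra.antipode K (Γ.basis K) =
    ∑ n ∈ Finset.range (Fintype.card Γ.E + 1), ∑ P : OrderedPartition Γ.E n,
      (-1 : K) ^ n • (List.ofFn fun i : Fin n => (Γ.restrict (P.block i)).basis K).prod := by
  refine (antipodeMap_basis Γ).trans ?_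
  simp only [partialAntipode_basis, reduced_pow_basis, Finset.smul_sum]

theorem antipode_empty : HopfAlgebra.antipode K (empty.basis K) = empty.basis K :=
  HopfAlgebra.antipode_one

theorem counit_empty : Coalgebra.counit (R := K) (empty.basis K) = (1 : K) :=
  Bialgebra.counit_one

end Space
end
end HeisenbergWeyl

theorem theorem3 (K : Type*) [Field K] :
    ∃ (_ : Ring (HeisenbergWeyl.Space K)) (_ : HopfAlgebra K (HeisenbergWeyl.Space K)),
      -- addition and scalar multiplication are those of formal linear combinations
      (∀ (x y : HeisenbergWeyl.Space K) (d : HeisenbergWeyl.Diagram),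
        (x + y).coeff d = x.coeff d + y.coeff d) ∧
      (∀ (c : K) (x : HeisenbergWeyl.Space K) (d : HeisenbergWeyl.Diagram),
        (c • x).coeff d = c * x.coeff d) ∧
      -- the product of two diagrams is the sum of all their compositions, the unit is void
      (∀ Γ₂ Γ₁ : HeisenbergWeyl.Graph,
        Γ₂.basis K * Γ₁.basis K =
          ∑ m : HeisenbergWeyl.Matching Γ₂ Γ₁, (HeisenbergWeyl.Graph.compose m).basis K) ∧
      (1 : HeisenbergWeyl.Space K) =
        HeisenbergWeyl.Space.ofDiagram K HeisenbergWeyl.Diagram.void ∧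
      -- coproduct
      (∀ Γ : HeisenbergWeyl.Graph,
        Coalgebra.comul (R := K) (Γ.basis K) =
          ∑ L : Set Γ.E, (Γ.restrict L).basis K ⊗ₜ[K] (Γ.restrict Lᶜ).basis K) ∧
      Coalgebra.IsCocomm K (HeisenbergWeyl.Space K) ∧
      -- counit
      Coalgebra.counit (R := K)
        (HeisenbergWeyl.Space.ofDiagram K HeisenbergWeyl.Diagram.void) = 1 ∧
      (∀ d : HeisenbergWeyl.Diagram, d ≠ HeisenbergWeyl.Diagram.void →
        Coalgebra.counit (R := K) (HeisenbergWeyl.Space.ofDiagram K d) = 0) ∧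
      -- antipode
      HopfAlgebra.antipode K (HeisenbergWeyl.Space.ofDiagram K HeisenbergWeyl.Diagram.void) =
        HeisenbergWeyl.Space.ofDiagram K HeisenbergWeyl.Diagram.void ∧
      (∀ Γ : HeisenbergWeyl.Graph, Γ.diagram ≠ HeisenbergWeyl.Diagram.void →
        HopfAlgebra.antipode K (Γ.basis K) =
          ∑ n ∈ Finset.range (Fintype.card Γ.E + 1),
            ∑ P : HeisenbergWeyl.OrderedPartition Γ.E n,
              (-1 : K) ^ n •
                (List.ofFn fun i : Fin n => (Γ.restrict (P.block i)).basis K).prod) := by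
  classical
  refine ⟨HeisenbergWeyl.Space.instRing, HeisenbergWeyl.Space.instHopfAlgebra, fun x y d => rfl,
    fun c x d => rfl, fun Γ₂ Γ₁ => ?_, rfl, HeisenbergWeyl.Space.comul_basis,
    HeisenbergWeyl.Space.instIsCocomm, HeisenbergWeyl.Space.counit_empty, fun d hd => ?_,
    HeisenbergWeyl.Space.antipode_empty, fun Γ _ => HeisenbergWeyl.Space.antipode_basis Γ⟩
  · rw [HeisenbergWeyl.Space.basis_mul_basis, HeisenbergWeyl.Flags.prodSum_flags]
  · induction d using Quotient.ind with
    | _ Γ =>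
      refine (HeisenbergWeyl.Space.counit_basis Γ).trans (if_neg fun h => hd ?_)
      exact HeisenbergWeyl.Graph.diagram_eq_void_iff.2 h
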